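/- Let $T>0$ and $B$ be real numbers, let $M$ be a symmetric positive definite $m\times m$ matrix, and let $V:\mathbb R^m\to[0,\infty)$ be of class $C^4$. Put $f=-\nabla V$ and suppose that the Fréchet derivatives $f',f^{(2)},f^{(3)}$ are bounded by $B$ (in operator norm) on all of $\mathbb R^m$. Let $H(q,p)=\tfrac12\langle p,M^{-1}p\rangle+V(q)$, and for $h>0$ let $\psi_h(q,p)=(q_h,p_h)$ be one leapfrog step, $$p_{h/2}=p+\tfrac h2 f(q),\qquad q_h=q+hM^{-1}p_{h/2},\qquad p_h=p_{h/2}+\tfrac h2 f(q_h).$$ Let $\psi_h^{(T)}=\psi_h^{\lfloor T/h\rfloor}$ be the $\lfloor T/h\rfloor$-fold iterate of $\psi_h$, and for $x\in\mathbb R^{2m}$ put $\Delta(x,h)=H(\psi_h^{(T)}(x))-H(x)$. For every $x\in\mathbb R^{2m}$ the system $\dot q=M^{-1}p$, $\dot p=f(q)$ has a unique solution $(q(t),p(t))_{t\in\mathbb R}$ with $(q(0),p(0))=x$; it satisfies $H(q(T),p(T))=H(x)$, so that $\Delta(x,h)$ is the energy error of the leapfrog scheme at time $T$. The variational system $$\dot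 u=f'(q(t))\,v+\tfrac1{12}\dddot p(t),\qquad \dot v=M^{-1}u-\tfrac16\dddot q(t),\qquad u(0)=v(0)=0,$$ has a unique solution $(u(t),v(t))_{t\in\mathbb R}$. Moreover $$\Delta(x,h)=h^2\alpha(x)+h^2\rho(x,h)\quad(h>0),\qquad \alpha(x)=\langle M^{-1}p(T),u(T)\rangle-\langle f(q(T)),v(T)\rangle,$$ and, with $\|g(\cdot)\|_\infty=\sup_{0\le t\le T}|g(t)|$, there is a constant $K$ depending only on $B$, $T$, $\|M\|$ and $\|M^{-1}\|$ (not on $m$, $V$, $x$ or $h$) such that $$|\alpha(x)|\le K\bigl(\|p(\cdot)\|_\infty^3+\|f(q(\cdot))\|_\infty^2+1\bigr),$$ $$|\rho(x,h)|\le Kh\bigl(\|p(\cdot)\|_\infty^8+\|f(q(\cdot))\|_\infty^2+1\bigr),\qquad 0<h\le1.$$ -/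

import Mathlib

noncomputable section

namespace Leapfrog

/-- `ℝ^m` with the Euclidean norm and inner product. -/
abbrev Vec (m : ℕ) : Type := EuclideanSpace ℝ (Fin m)

/-- The linear operator on `ℝ^m` given by a matrix; its norm is the operator norm induced by the
Euclidean norm. -/
abbrev op {m : ℕ} (A : Matrix (Fin m) (Fin m) ℝ) : Vec m →L[ℝ] Vec m :=
  Matrix.toEuclideanCLM (n := Fin m) (𝕜 := ℝ) A

/-- The force `f = -∇V`. -/
def force {m : ℕ} (V : Vec m → ℝ) (q : Vec m) : Vec m := -gradient V q

/-- The Hamiltonian `H(q,p) = ½⟨p, M⁻¹p⟩ + V(q)`; a state is a pair `x = (q,p)`. -/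
def energy {m : ℕ} (M : Matrix (Fin m) (Fin m) ℝ) (V : Vec m → ℝ) (x : Vec m × Vec m) : ℝ :=
  (1 / 2 : ℝ) * inner ℝ x.2 (op M⁻¹ x.2) + V x.1

/-- `V` is a nonnegative function of class `C⁴`, and the first three Fréchet derivatives of the
force are bounded by `B` on the whole space. -/
structure AdmissiblePotential {m : ℕ} (V : Vec m → ℝ) (B : ℝ) : Prop where
  contDiff : ContDiff ℝ 4 V
  nonneg : ∀ q, 0 ≤ V q
  bound : ∀ k : ℕ, 1 ≤ k → k ≤ 3 → ∀ q, ‖iteratedFDeriv ℝ k (force V) q‖ ≤ B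

/-- `(q(·),p(·))` solves `dq/dt = M⁻¹p`, `dp/dt = -∇V(q)` with `(q(0),p(0)) = x`. -/
structure IsTrajectory {m : ℕ} (M : Matrix (Fin m) (Fin m) ℝ) (V : Vec m → ℝ)
    (x : Vec m × Vec m) (q p : ℝ → Vec m) : Prop where
  deriv_q : ∀ t, HasDerivAt q (op M⁻¹ (p t)) t
  deriv_p : ∀ t, HasDerivAt p (force V (q t)) t
  initial : (q 0, p 0) = x

/-- `(u(·),v(·))` solves the variational system along `(q(·),p(·))`:
`du/dt = f'(q)v + (1/12)p'''`, `dv/dt = M⁻¹u - (1/6)q'''`, `u(0) = v(0) = 0`. -/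
structure IsVariationalSolution {m : ℕ} (M : Matrix (Fin m) (Fin m) ℝ) (V : Vec m → ℝ)
    (q p u v : ℝ → Vec m) : Prop where
  deriv_u : ∀ t, HasDerivAt u
    (fderiv ℝ (force V) (q t) (v t) + (1 / 12 : ℝ) • iteratedDeriv 3 p t) t
  deriv_v : ∀ t, HasDerivAt v (op M⁻¹ (u t) - (1 / 6 : ℝ) • iteratedDeriv 3 q t) t
  initial_u : u 0 = 0
  initial_v : v 0 = 0

/-- One leapfrog (Störmer–Verlet) step of length `h`: half kick, drift, half kick. -/
def step {m : ℕ} (M : Matrix (Fin m) (Fin m) ℝ) (V : Vec m → ℝ) (h : ℝ)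
    (x : Vec m × Vec m) : Vec m × Vec m :=
  let pHalf := x.2 - (h / 2) • gradient V x.1
  let qNew := x.1 + h • op M⁻¹ pHalf
  (qNew, pHalf - (h / 2) • gradient V qNew)

/-- The leapfrog approximation of the flow over time `T`: `⌊T/h⌋` steps of length `h`. -/
def integrator {m : ℕ} (M : Matrix (Fin m) (Fin m) ℝ) (V : Vec m → ℝ) (T h : ℝ) :
    Vec m × Vec m → Vec m × Vec m :=
  (step M V h)^[⌊T / h⌋₊]

/-- The energy increment `Δ(x,h)` of the leapfrog scheme over time `T`. -/
def energyError {m : ℕ} (M : Matrix (Fin m) (Fin m) ℝ) (V : Vec m → ℝ) (T : ℝ)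
    (x : Vec m × Vec m) (h : ℝ) : ℝ :=
  energy M V (integrator M V T h x) - energy M V x

/-- `‖g(·)‖_∞ = sup_{0 ≤ t ≤ T} |g(t)|`. -/
def supNorm {m : ℕ} (T : ℝ) (g : ℝ → Vec m) : ℝ := ⨆ t : Set.Icc (0 : ℝ) T, ‖g t‖

end Leapfrog

end

namespace Leapfrog

open Real Set

/-! Write `W = M⁻¹` and `w = W p`. One leapfrog step from `(q, p)` changes the energy by `h³ e(q, w)
+ O(h⁴)`, where `w` is the half-step velocity and `e(q, w) = ⟨f''(q)(w, w), w⟩ / 12 + ⟨f'(q) w, W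
f(q)⟩ / 4`. This follows from an exact identity: the step's energy change is the trapezoidal-rule
defect for `V` plus a quadratic expression in the forces (`trapezoid`, `local_energy_error`). The
numerical path stays within `O(h)` of the trajectory (`global_error`), so summing about `T / h`
local errors gives `h² ∫₀ᵀ e dt + O(h³)` along the exact flow (`energy_error`). Only first-order
convergence is needed, since the density already carries the factor `h³`.

The pairing `⟨W p, u⟩ - ⟨f(q), v⟩` vanishes at time `0`. Symmetry of `f'` and `W` cancels the
homogeneous terms of its derivative, and the forcing terms give exactly `e` (`hasDerivAt_pairing`).
So `α` is the integral of `e`.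

For the bounds, `p(T) - p(0)` is the integral of the force, which varies little because `f` is
Lipschitz; hence the force is controlled by the momentum alone (`norm_force_le`). The density is
then cubic, and the local remainder quartic, in one size `R`. -/

/-! ### Global solutions of Lipschitz differential equations -/

open MeasureTheory intervalIntegral in
/-- Global existence for an ordinary differential equation whose right-hand side is globally
Lipschitz in the state, uniformly in time. -/
theorem exists_global_solution {E : Type*} [NormedAddCommGroup E] [NormedSpace ℝ E]
    [CompleteSpace E] {v : ℝ → E → E} (hv : Continuous (Function.uncurry v)) {K : ℝ} (hK : 0 ≤ K)
    (hlip : ∀ t x y, ‖v t x - v t y‖ ≤ K * ‖x - y‖) (x₀ : E) :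
    ∃ y : ℝ → E, y 0 = x₀ ∧ ∀ t, HasDerivAt y (v t (y t)) t := by
  set c : ℝ → ℝ := fun t => ‖v t 0‖ with hc
  have hcc : Continuous c := (hv.comp (by fun_prop : Continuous fun t : ℝ => (t, (0 : E)))).norm
  have hci : ∀ a b, IntervalIntegrable c volume a b := fun a b => hcc.intervalIntegrable a b
  set F : ℝ → ℝ := fun t => ∫ s in (0 : ℝ)..t, c s with hF
  have hFc : Continuous F := continuous_primitive (fun a b => hci a b) 0
  have hFm : Monotone F := by
    intro a b hab
    have : F b - F a = ∫ s in a..b, c s := integral_interval_sub_left (hci _ _) (hci _ _)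
    have h2 : 0 ≤ ∫ s in a..b, c s := integral_nonneg hab fun s _ => norm_nonneg _
    linarith
  have hF0 : F 0 = 0 := by simp [hF]
  -- An even majorant of `1 + |F|`, increasing in `|t|`, which treats both time directions at once.
  set m : ℝ → ℝ := fun t => 1 + F |t| - F (-|t|) with hm
  have hmc : Continuous m := by fun_prop
  have hmm : ∀ s t, |s| ≤ |t| → m s ≤ m t := by
    intro s t h
    have h1 := hFm h
    have h2 := hFm (neg_le_neg h)
    simp only [hm]; linarith
  have hFle : ∀ t, |F t| ≤ m t - 1 := by
    intro t
    have h1 := hFm (neg_abs_le t)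
    have h2 := hFm (le_abs_self t)
    have h3 := hFm (abs_nonneg t)
    have h4 := hFm (neg_nonpos.2 (abs_nonneg t))
    rw [hF0] at h3 h4
    rw [abs_le]; simp only [hm]; constructor <;> linarith
  have hm1 : ∀ t, 1 ≤ m t := fun t => by have := hFle t; have := abs_nonneg (F t); linarith
  set l : ℝ := 2 * K + 1 with hl
  have hl0 : 0 < l := by positivity
  -- Weight of a Bielecki norm on the whole line: `cosh` makes the Picard map contract in both
  -- directions, and `m` absorbs the growth of `v t 0`. The rate `l = 2 * K + 1` is positive even
  -- for `K = 0` and gives `K / l ≤ 1 / 2`.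
  set ω : ℝ → ℝ := fun t => cosh (l * t) * m t with hω
  have hωc : Continuous ω := by fun_prop
  have hω1 : ∀ t, 1 ≤ ω t := fun t => one_le_mul_of_one_le_of_one_le (one_le_cosh _) (hm1 t)
  have hω0 : ∀ t, 0 < ω t := fun t => by linarith [hω1 t]
  have hmω : ∀ t, m t ≤ ω t := fun t =>
    le_mul_of_one_le_left (by linarith [hm1 t]) (one_le_cosh _)
  have hcosh : ∀ t, ∫ s in (0 : ℝ)..t, cosh (l * s) = sinh (l * t) / l := by
    intro t
    have := integral_eq_sub_of_hasDerivAt (a := 0) (b := t) (f := fun s => sinh (l * s) / l)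
      (f' := fun s => cosh (l * s)) (fun s _ => by
        have := (((hasDerivAt_id s).const_mul l).sinh).div_const l
        simpa [hl0.ne'] using this)
      ((by fun_prop : Continuous fun s => cosh (l * s)).intervalIntegrable _ _)
    simpa using this
  have hωint : ∀ t, |∫ s in (0 : ℝ)..t, ω s| ≤ ω t / l := by
    intro t
    have hb : |∫ s in (0 : ℝ)..t, ω s| ≤ |∫ s in (0 : ℝ)..t, cosh (l * s) * m t| := by
      have := norm_integral_le_abs_of_norm_le (f := ω) (μ := volume) (a := 0) (b := t)
        (g := fun s => cosh (l * s) * m t) ?_ ?_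
      · simpa using this
      · refine (ae_restrict_iff' measurableSet_uIoc).2 (Filter.Eventually.of_forall fun s hs => ?_)
        have hst : |s| ≤ |t| := by
          rcases le_total 0 t with h | h
          · rw [uIoc_of_le h] at hs
            rw [abs_of_pos hs.1, abs_of_nonneg h]; exact hs.2
          · rw [uIoc_of_ge h] at hs
            rw [abs_of_nonpos hs.2, abs_of_nonpos h]; linarith [hs.1]
        rw [Real.norm_eq_abs, abs_of_pos (hω0 s)]
        exact mul_le_mul_of_nonneg_left (hmm s t hst) (cosh_pos _).le
      · exact (by fun_prop : Continuous fun s => cosh (l * s) * m t).intervalIntegrable _ _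
    refine hb.trans ?_
    rw [intervalIntegral.integral_mul_const, hcosh, abs_mul, abs_div, abs_of_pos hl0,
      abs_of_pos (by linarith [hm1 t] : 0 < m t), div_mul_eq_mul_div]
    refine div_le_div_of_nonneg_right ?_ hl0.le
    refine mul_le_mul_of_nonneg_right ?_ (by linarith [hm1 t])
    rw [abs_le]
    constructor <;> rw [sinh_eq, cosh_eq] <;> linarith [exp_pos (l * t), exp_pos (-(l * t))]
  have hint : ∀ g : BoundedContinuousFunction ℝ E, Continuous fun s => v s (ω s • g s) := fun g =>
    hv.comp (by fun_prop : Continuous fun s : ℝ => (s, ω s • g s))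
  have hbound : ∀ g : BoundedContinuousFunction ℝ E, ∀ t,
      ‖x₀ + ∫ s in (0 : ℝ)..t, v s (ω s • g s)‖ ≤ (‖x₀‖ + 1 + K * ‖g‖ / l) * ω t := by
    intro g t
    have h1 : ‖∫ s in (0 : ℝ)..t, v s (ω s • g s)‖
        ≤ |∫ s in (0 : ℝ)..t, (c s + K * ‖g‖ * ω s)| := by
      refine norm_integral_le_abs_of_norm_le (Filter.Eventually.of_forall fun s => ?_)
        ((by fun_prop : Continuous fun s => c s + K * ‖g‖ * ω s).intervalIntegrable _ _)
      have h2 := hlip s (ω s • g s) 0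
      have h3 : ‖v s (ω s • g s)‖ ≤ ‖v s 0‖ + ‖v s (ω s • g s) - v s 0‖ := by
        simpa using norm_add_le (v s 0) (v s (ω s • g s) - v s 0)
      have h4 : ‖ω s • g s - 0‖ ≤ ω s * ‖g‖ := by
        rw [sub_zero, norm_smul, Real.norm_eq_abs, abs_of_pos (hω0 s)]
        exact mul_le_mul_of_nonneg_left (g.norm_coe_le_norm s) (hω0 s).le
      have h5 := mul_le_mul_of_nonneg_left h4 hK
      simp only [hc]; linarith
    have h2 : |∫ s in (0 : ℝ)..t, (c s + K * ‖g‖ * ω s)| ≤ (m t - 1) + K * ‖g‖ * (ω t / l) := by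
      rw [intervalIntegral.integral_add (hci _ _)
        ((by fun_prop : Continuous fun s => K * ‖g‖ * ω s).intervalIntegrable _ _),
        intervalIntegral.integral_const_mul]
      refine (abs_add_le _ _).trans (add_le_add (hFle t) ?_)
      rw [abs_mul, abs_of_nonneg (by positivity : 0 ≤ K * ‖g‖)]
      exact mul_le_mul_of_nonneg_left (hωint t) (by positivity)
    have h3 := norm_add_le x₀ (∫ s in (0 : ℝ)..t, v s (ω s • g s))
    have h4 : ‖x₀‖ ≤ ‖x₀‖ * ω t := le_mul_of_one_le_right (norm_nonneg _) (hω1 t)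
    have h5 := hmω t
    have h6 : K * ‖g‖ * (ω t / l) = K * ‖g‖ / l * ω t := by ring
    nlinarith
  have hprim : ∀ g : BoundedContinuousFunction ℝ E,
      Continuous fun t => x₀ + ∫ s in (0 : ℝ)..t, v s (ω s • g s) := fun g =>
    continuous_const.add (continuous_primitive (fun a b => (hint g).intervalIntegrable a b) 0)
  -- The Picard operator conjugated by the weight: it acts on the bounded function `g = y / ω`.
  let Φ : BoundedContinuousFunction ℝ E → BoundedContinuousFunction ℝ E := fun g =>
    BoundedContinuousFunction.ofNormedAddCommGroup
      (fun t => (ω t)⁻¹ • (x₀ + ∫ s in (0 : ℝ)..t, v s (ω s • g s)))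
      ((hωc.inv₀ fun t => (hω0 t).ne').smul (hprim g)) (‖x₀‖ + 1 + K * ‖g‖ / l) (by
        intro t
        rw [norm_smul, norm_inv, Real.norm_eq_abs, abs_of_pos (hω0 t), inv_mul_le_iff₀ (hω0 t),
          mul_comm]
        exact hbound g t)
  have hcontr : ContractingWith (1 / 2) Φ := by
    refine ⟨by rw [← NNReal.coe_lt_coe]; push_cast; norm_num, LipschitzWith.of_dist_le_mul fun g g' => ?_⟩
    push_cast
    refine (BoundedContinuousFunction.dist_le (by positivity)).2 fun t => ?_
    change dist ((ω t)⁻¹ • (x₀ + ∫ s in (0 : ℝ)..t, v s (ω s • g s)))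
      ((ω t)⁻¹ • (x₀ + ∫ s in (0 : ℝ)..t, v s (ω s • g' s))) ≤ 1 / 2 * dist g g'
    rw [dist_eq_norm, ← smul_sub, add_sub_add_left_eq_sub,
      ← integral_sub ((hint g).intervalIntegrable _ _) ((hint g').intervalIntegrable _ _),
      norm_smul, norm_inv, Real.norm_eq_abs, abs_of_pos (hω0 t), inv_mul_le_iff₀ (hω0 t)]
    have h1 : ‖∫ s in (0 : ℝ)..t, (v s (ω s • g s) - v s (ω s • g' s))‖
        ≤ |∫ s in (0 : ℝ)..t, K * dist g g' * ω s| := by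
      refine norm_integral_le_abs_of_norm_le (Filter.Eventually.of_forall fun s => ?_)
        ((by fun_prop : Continuous fun s => K * dist g g' * ω s).intervalIntegrable _ _)
      refine (hlip s _ _).trans ?_
      rw [← smul_sub, norm_smul, Real.norm_eq_abs, abs_of_pos (hω0 s), mul_assoc K, ← dist_eq_norm,
        mul_comm (ω s) (dist _ _)]
      exact mul_le_mul_of_nonneg_left
        (mul_le_mul_of_nonneg_right (g.dist_coe_le_dist s) (hω0 s).le) hK
    refine h1.trans ?_
    rw [intervalIntegral.integral_const_mul, abs_mul,
      abs_of_nonneg (by positivity : 0 ≤ K * dist g g')]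
    refine (mul_le_mul_of_nonneg_left (hωint t) (by positivity)).trans ?_
    have h2 : K / l ≤ 1 / 2 := by rw [div_le_iff₀ hl0]; linarith
    have h3 : 0 ≤ dist g g' * ω t := mul_nonneg dist_nonneg (hω0 t).le
    calc K * dist g g' * (ω t / l) = K / l * (dist g g' * ω t) := by ring
      _ ≤ 1 / 2 * (dist g g' * ω t) := mul_le_mul_of_nonneg_right h2 h3
      _ = ω t * (1 / 2 * dist g g') := by ring
  obtain ⟨g, hg⟩ : ∃ g, Φ g = g := ⟨_, hcontr.fixedPoint_isFixedPt⟩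
  have hy : ∀ t, ω t • g t = x₀ + ∫ s in (0 : ℝ)..t, v s (ω s • g s) := by
    intro t
    have h1 : (ω t)⁻¹ • (x₀ + ∫ s in (0 : ℝ)..t, v s (ω s • g s)) = g t :=
      congrArg (fun k : BoundedContinuousFunction ℝ E => k t) hg
    conv_lhs => rw [← h1]
    rw [smul_smul, mul_inv_cancel₀ (hω0 t).ne', one_smul]
  refine ⟨fun t => ω t • g t, by simpa using hy 0, fun t => ?_⟩
  have h1 := ((integral_hasDerivAt_right ((hint g).intervalIntegrable 0 t)
    ((hint g).stronglyMeasurableAtFilter _ _) (hint g).continuousAt).const_add x₀)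
  exact h1.congr_of_eventuallyEq (Filter.Eventually.of_forall hy)


/-! ### Force fields and their Taylor estimates -/

variable {E : Type*} [NormedAddCommGroup E] [InnerProductSpace ℝ E] [CompleteSpace E]

/-- A conservative force field `f = -∇V` with first two derivatives `f₁`, `f₂`, such that `f`, `f₁`
and `f₂` are Lipschitz with constant `L ≥ 1`. -/
structure IsForceField (V : E → ℝ) (f : E → E) (f₁ : E → E →L[ℝ] E)
    (f₂ : E → E →L[ℝ] E →L[ℝ] E) (L : ℝ) : Prop where
  one_le : 1 ≤ L
  hasGradientAt : ∀ q, HasGradientAt V (-f q) q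
  hasFDerivAt : ∀ q, HasFDerivAt f (f₁ q) q
  hasFDerivAt₁ : ∀ q, HasFDerivAt f₁ (f₂ q) q
  norm_le₁ : ∀ q, ‖f₁ q‖ ≤ L
  norm_le₂ : ∀ q, ‖f₂ q‖ ≤ L
  lipschitz₂ : ∀ q r, ‖f₂ q - f₂ r‖ ≤ L * ‖q - r‖
  symmetric : ∀ q a b, inner ℝ (f₁ q a) b = inner ℝ a (f₁ q b)

/-- The leading coefficient of the local energy error of the leapfrog scheme, at position `q` and
velocity `w`. -/
noncomputable def errorDensity (W : E →L[ℝ] E) (f : E → E) (f₁ : E → E →L[ℝ] E)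
    (f₂ : E → E →L[ℝ] E →L[ℝ] E) (q w : E) : ℝ :=
  (1 / 12 : ℝ) * inner ℝ (f₂ q w w) w + (1 / 4 : ℝ) * inner ℝ (f₁ q w) (W (f q))

namespace IsForceField

variable {V : E → ℝ} {f : E → E} {f₁ : E → E →L[ℝ] E} {f₂ : E → E →L[ℝ] E →L[ℝ] E} {L : ℝ}

theorem nonneg (hf : IsForceField V f f₁ f₂ L) : 0 ≤ L := zero_le_one.trans hf.one_le

theorem norm_force_sub_le (hf : IsForceField V f f₁ f₂ L) (q r : E) :
    ‖f q - f r‖ ≤ L * ‖q - r‖ :=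
  convex_univ.norm_image_sub_le_of_norm_hasFDerivWithin_le
    (fun x _ => (hf.hasFDerivAt x).hasFDerivWithinAt) (fun x _ => hf.norm_le₁ x)
    (mem_univ r) (mem_univ q)

theorem norm_deriv_sub_le (hf : IsForceField V f f₁ f₂ L) (q r : E) :
    ‖f₁ q - f₁ r‖ ≤ L * ‖q - r‖ :=
  convex_univ.norm_image_sub_le_of_norm_hasFDerivWithin_le
    (fun x _ => (hf.hasFDerivAt₁ x).hasFDerivWithinAt) (fun x _ => hf.norm_le₂ x)
    (mem_univ r) (mem_univ q)

omit [CompleteSpace E] in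
theorem hasDerivAt_line (q a : E) (s : ℝ) : HasDerivAt (fun s : ℝ => q + s • a) a s := by
  simpa using ((hasDerivAt_id s).smul_const a).const_add q

theorem hasDerivAt_comp_line (hf : IsForceField V f f₁ f₂ L) (q a : E) (s : ℝ) :
    HasDerivAt (fun s : ℝ => f (q + s • a)) (f₁ (q + s • a) a) s :=
  (hf.hasFDerivAt _).comp_hasDerivAt s (hasDerivAt_line q a s)

theorem hasDerivAt₁_comp_line (hf : IsForceField V f f₁ f₂ L) (q a : E) (s : ℝ) :
    HasDerivAt (fun s : ℝ => f₁ (q + s • a) a) (f₂ (q + s • a) a a) s := by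
  have h := (hf.hasFDerivAt₁ _).comp_hasDerivAt s (hasDerivAt_line q a s)
  simpa using h.clm_apply (hasDerivAt_const s a)

theorem hasDerivAt_potential_comp_line (hf : IsForceField V f f₁ f₂ L) (q a : E) (s : ℝ) :
    HasDerivAt (fun s : ℝ => V (q + s • a)) (-inner ℝ (f (q + s • a)) a) s := by
  have h := (hf.hasGradientAt (q + s • a)).hasFDerivAt.comp_hasDerivAt s (hasDerivAt_line q a s)
  rw [InnerProductSpace.toDual_apply_apply, inner_neg_left] at h
  exact h

theorem taylor_one (hf : IsForceField V f f₁ f₂ L) (q a : E) :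
    ‖f (q + a) - f q - f₁ q a‖ ≤ L * ‖a‖ ^ 2 := by
  have h := norm_image_sub_le_of_norm_deriv_le_segment_01'
    (f := fun s : ℝ => f (q + s • a) - s • f₁ q a)
    (f' := fun s => f₁ (q + s • a) a - f₁ q a) (C := L * ‖a‖ ^ 2) ?_ ?_
  · convert h using 2
    simp only [one_smul, zero_smul, add_zero, sub_zero]
    abel
  · intro s _
    have := (hf.hasDerivAt_comp_line q a s).fun_sub ((hasDerivAt_id s).smul_const (f₁ q a))
    simpa using this.hasDerivWithinAt
  · intro s hs
    have h1 := (f₁ (q + s • a) - f₁ q).le_opNorm a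
    have h2 := hf.norm_deriv_sub_le (q + s • a) q
    have h3 : ‖q + s • a - q‖ ≤ ‖a‖ := by
      rw [add_sub_cancel_left, norm_smul, Real.norm_eq_abs, abs_of_nonneg hs.1]
      exact mul_le_of_le_one_left (norm_nonneg _) hs.2.le
    calc ‖f₁ (q + s • a) a - f₁ q a‖ ≤ ‖f₁ (q + s • a) - f₁ q‖ * ‖a‖ := h1
      _ ≤ (L * ‖a‖) * ‖a‖ := by
        gcongr
        exact h2.trans (mul_le_mul_of_nonneg_left h3 hf.nonneg)
      _ = L * ‖a‖ ^ 2 := by ring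

/-- On differentiating in `s` the `f₁` terms cancel, leaving `s` times a difference of values of
`f₂`; its Lipschitz bound suffices. The expression is the integrand of the trapezoidal defect. -/
theorem taylor_two_aux (hf : IsForceField V f f₁ f₂ L) (q a : E) {s : ℝ} (hs : s ∈ Icc (0 : ℝ) 1) :
    ‖f q - f (q + s • a) + s • f₁ (q + s • a) a - (s ^ 2 / 2) • f₂ q a a‖ ≤ L * ‖a‖ ^ 3 := by
  have h := norm_image_sub_le_of_norm_deriv_le_segment' (a := 0) (b := 1)
    (f := fun s : ℝ => f q - f (q + s • a) + s • f₁ (q + s • a) a - (s ^ 2 / 2) • f₂ q a a)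
    (f' := fun s => s • (f₂ (q + s • a) a a - f₂ q a a)) (C := L * ‖a‖ ^ 3) ?_ ?_ s hs
  · have hc : 0 ≤ L * ‖a‖ ^ 3 := mul_nonneg hf.nonneg (by positivity)
    refine (le_of_eq ?_).trans (h.trans ?_)
    · simp
    · rw [sub_zero]; exact mul_le_of_le_one_right hc hs.2
  · intro s _
    have h1 := (hf.hasDerivAt_comp_line q a s).const_sub (f q)
    have h2 := (hasDerivAt_id s).fun_smul (hf.hasDerivAt₁_comp_line q a s)
    have h3 := (((hasDerivAt_id s).fun_pow 2).div_const 2).smul_const (f₂ q a a)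
    refine ((h1.fun_add h2).fun_sub h3).hasDerivWithinAt.congr_deriv ?_
    simp only [id, one_smul, smul_sub]
    norm_num
  · intro s hs
    have h3 : ‖q + s • a - q‖ ≤ ‖a‖ := by
      rw [add_sub_cancel_left, norm_smul, Real.norm_eq_abs, abs_of_nonneg hs.1]
      exact mul_le_of_le_one_left (norm_nonneg _) hs.2.le
    calc ‖s • (f₂ (q + s • a) a a - f₂ q a a)‖ ≤ ‖(f₂ (q + s • a) - f₂ q) a a‖ := by
          rw [norm_smul, Real.norm_eq_abs, abs_of_nonneg hs.1]
          exact mul_le_of_le_one_left (norm_nonneg _) hs.2.le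
      _ ≤ ‖f₂ (q + s • a) - f₂ q‖ * ‖a‖ * ‖a‖ := ContinuousLinearMap.le_opNorm₂ _ _ _
      _ ≤ (L * ‖a‖) * ‖a‖ * ‖a‖ := by
        gcongr
        exact (hf.lipschitz₂ _ _).trans (mul_le_mul_of_nonneg_left h3 hf.nonneg)
      _ = L * ‖a‖ ^ 3 := by ring

/-- The trapezoidal rule for the potential, with its leading error term. -/
theorem trapezoid (hf : IsForceField V f f₁ f₂ L) (q a : E) :
    |V (q + a) - V q + 1 / 2 * inner ℝ (f q + f (q + a)) a - 1 / 12 * inner ℝ (f₂ q a a) a|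
      ≤ L * ‖a‖ ^ 4 := by
  have h := norm_image_sub_le_of_norm_deriv_le_segment_01'
    -- The trapezoidal defect over the segment of length `s`; its derivative is half the pairing of
    -- the expression in `taylor_two_aux` with `a`.
    (f := fun s : ℝ => V (q + s • a)
      + s * (1 / 2 * (inner ℝ (f q) a + inner ℝ (f (q + s • a)) a))
      - s ^ 3 * (1 / 12 * inner ℝ (f₂ q a a) a))
    (f' := fun s => 1 / 2 * inner ℝ (f q - f (q + s • a) + s • f₁ (q + s • a) a
      - (s ^ 2 / 2) • f₂ q a a) a) (C := L * ‖a‖ ^ 4) ?_ ?_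
  · rw [Real.norm_eq_abs] at h
    convert h using 2
    simp only [one_smul, zero_smul, add_zero, inner_add_left]
    ring
  · intro s _
    have h1 := hf.hasDerivAt_potential_comp_line q a s
    have h2 : HasDerivAt (fun s : ℝ => inner ℝ (f (q + s • a)) a)
        (inner ℝ (f₁ (q + s • a) a) a) s := by
      simpa using (hf.hasDerivAt_comp_line q a s).inner ℝ (hasDerivAt_const s a)
    have h3 := (hasDerivAt_id s).fun_mul ((h2.const_add (inner ℝ (f q) a)).const_mul (1 / 2 : ℝ))
    have h4 := ((hasDerivAt_id s).fun_pow 3).mul_const (1 / 12 * inner ℝ (f₂ q a a) a)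
    refine ((h1.fun_add h3).fun_sub h4).hasDerivWithinAt.congr_deriv ?_
    simp only [id, inner_sub_left, inner_add_left, real_inner_smul_left]
    norm_num
    ring
  · intro s hs
    have h1 := hf.taylor_two_aux q a (Ico_subset_Icc_self hs)
    rw [norm_mul, Real.norm_eq_abs (inner ℝ _ _)]
    have h2 := abs_real_inner_le_norm (f q - f (q + s • a) + s • f₁ (q + s • a) a
      - (s ^ 2 / 2) • f₂ q a a) a
    have h3 := mul_le_mul_of_nonneg_right h1 (norm_nonneg a)
    have h4 : L * ‖a‖ ^ 3 * ‖a‖ = L * ‖a‖ ^ 4 := by ring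
    have h5 : 0 ≤ L * ‖a‖ ^ 4 := mul_nonneg hf.nonneg (by positivity)
    norm_num
    linarith

/-! ### Size and Lipschitz bounds of the error density -/

section errorDensity

variable {W : E →L[ℝ] E}

omit [CompleteSpace E] in
theorem abs_inner_apply_le (A : E →L[ℝ] E) (a b : E) : |inner ℝ (A a) b| ≤ ‖A‖ * ‖a‖ * ‖b‖ :=
  (abs_real_inner_le_norm _ _).trans (mul_le_mul_of_nonneg_right (A.le_opNorm a) (norm_nonneg _))

omit [CompleteSpace E] in
theorem abs_inner_apply_apply_le (A : E →L[ℝ] E →L[ℝ] E) (a b c : E) :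
    |inner ℝ (A a b) c| ≤ ‖A‖ * ‖a‖ * ‖b‖ * ‖c‖ :=
  (abs_real_inner_le_norm _ _).trans
    (mul_le_mul_of_nonneg_right (A.le_opNorm₂ a b) (norm_nonneg _))

omit [CompleteSpace E] in
theorem norm_velocity_le (hW : ‖W‖ ≤ L) (a : E) {R : ℝ} (ha : ‖a‖ ≤ R) : ‖W a‖ ≤ L * R :=
  W.le_of_opNorm_le_of_le hW ha

theorem abs_errorDensity_le (hf : IsForceField V f f₁ f₂ L) (hW : ‖W‖ ≤ L) {q w : E} {S : ℝ}
    (hS : 1 ≤ S) (hw : ‖w‖ ≤ S) (hq : ‖f q‖ ≤ S) :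
    |errorDensity W f f₁ f₂ q w| ≤ L ^ 2 * S ^ 3 := by
  have hL := hf.one_le
  have h0 := hf.nonneg
  have h1 : |inner ℝ (f₂ q w w) w| ≤ L * S * S * S :=
    (abs_inner_apply_apply_le _ _ _ _).trans (by gcongr; exact hf.norm_le₂ q)
  have h2 : |inner ℝ (f₁ q w) (W (f q))| ≤ L * S * (L * S) :=
    (abs_inner_apply_le _ _ _).trans (by
      gcongr
      · exact hf.norm_le₁ q
      · exact norm_velocity_le hW _ hq)
  have h3 : L * S * S * S ≤ L ^ 2 * S ^ 3 := by
    calc L * S * S * S = L * S ^ 3 := by ring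
      _ ≤ L ^ 2 * S ^ 3 := by gcongr; exact le_self_pow₀ hL (by norm_num)
  have h4 : L * S * (L * S) ≤ L ^ 2 * S ^ 3 := by
    calc L * S * (L * S) = L ^ 2 * S ^ 2 := by ring
      _ ≤ L ^ 2 * S ^ 3 := by gcongr; norm_num
  rw [abs_le] at h1 h2 ⊢
  unfold errorDensity
  constructor <;> nlinarith

/-- The arguments are exchanged one at a time, giving four differences from the cubic term and three
from the other. The force at `q'` enters only through `f q - f q'`, so a bound at `q` is enough. -/
theorem abs_errorDensity_sub_le (hf : IsForceField V f f₁ f₂ L) (hW : ‖W‖ ≤ L)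
    {q q' w w' : E} {S : ℝ} (hS : 1 ≤ S) (hw : ‖w‖ ≤ S) (hw' : ‖w'‖ ≤ S)
    (hq : ‖f q‖ ≤ S) :
    |errorDensity W f f₁ f₂ q w - errorDensity W f f₁ f₂ q' w'|
      ≤ L ^ 3 * S ^ 3 * (‖q - q'‖ + ‖w - w'‖) := by
  have hL := hf.one_le
  have h0 := hf.nonneg
  set d := ‖q - q'‖
  set δ := ‖w - w'‖
  have hd : 0 ≤ d := norm_nonneg _
  have hδ : 0 ≤ δ := norm_nonneg _
  have a1 : |inner ℝ ((f₂ q - f₂ q') w w) w| ≤ (L * d) * S * S * S :=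
    (abs_inner_apply_apply_le _ _ _ _).trans (by gcongr; exact hf.lipschitz₂ q q')
  have a2 : |inner ℝ (f₂ q' (w - w') w) w| ≤ L * δ * S * S :=
    (abs_inner_apply_apply_le _ _ _ _).trans (by gcongr; exact hf.norm_le₂ q')
  have a3 : |inner ℝ (f₂ q' w' (w - w')) w| ≤ L * S * δ * S :=
    (abs_inner_apply_apply_le _ _ _ _).trans (by gcongr; exact hf.norm_le₂ q')
  have a4 : |inner ℝ (f₂ q' w' w') (w - w')| ≤ L * S * S * δ :=
    (abs_inner_apply_apply_le _ _ _ _).trans (by gcongr; exact hf.norm_le₂ q')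
  have b1 : |inner ℝ ((f₁ q - f₁ q') w) (W (f q))| ≤ (L * d) * S * (L * S) :=
    (abs_inner_apply_le _ _ _).trans (by
      gcongr
      · exact hf.norm_deriv_sub_le q q'
      · exact norm_velocity_le hW _ hq)
  have b2 : |inner ℝ (f₁ q' (w - w')) (W (f q))| ≤ L * δ * (L * S) :=
    (abs_inner_apply_le _ _ _).trans (by
      gcongr
      · exact hf.norm_le₁ q'
      · exact norm_velocity_le hW _ hq)
  have b3 : |inner ℝ (f₁ q' w') (W (f q - f q'))| ≤ L * S * (L * (L * d)) :=
    (abs_inner_apply_le _ _ _).trans (by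
      gcongr
      · exact hf.norm_le₁ q'
      · exact norm_velocity_le hW _ (hf.norm_force_sub_le q q'))
  have hS2 : S ≤ S ^ 3 := le_self_pow₀ hS (by norm_num)
  have hS3 : S ^ 2 ≤ S ^ 3 := pow_le_pow_right₀ hS (by norm_num)
  have hL1 : L ≤ L ^ 3 := le_self_pow₀ hL (by norm_num)
  have hL2 : L ^ 2 ≤ L ^ 3 := pow_le_pow_right₀ hL (by norm_num)
  have c1 : (L * d) * S * S * S ≤ L ^ 3 * S ^ 3 * d := by
    calc (L * d) * S * S * S = L * S ^ 3 * d := by ring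
      _ ≤ _ := by gcongr
  have c2 : L * δ * S * S ≤ L ^ 3 * S ^ 3 * δ := by
    calc L * δ * S * S = L * S ^ 2 * δ := by ring
      _ ≤ _ := by gcongr
  have c3 : (L * d) * S * (L * S) ≤ L ^ 3 * S ^ 3 * d := by
    calc (L * d) * S * (L * S) = L ^ 2 * S ^ 2 * d := by ring
      _ ≤ _ := by gcongr
  have c4 : L * δ * (L * S) ≤ L ^ 3 * S ^ 3 * δ := by
    calc L * δ * (L * S) = L ^ 2 * S * δ := by ring
      _ ≤ _ := by gcongr
  have c5 : L * S * (L * (L * d)) ≤ L ^ 3 * S ^ 3 * d := by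
    calc L * S * (L * (L * d)) = L ^ 3 * S * d := by ring
      _ ≤ _ := by gcongr
  have c6 : L * S * δ * S = L * δ * S * S := by ring
  have c7 : L * S * S * δ = L * δ * S * S := by ring
  have key : errorDensity W f f₁ f₂ q w - errorDensity W f f₁ f₂ q' w'
      = 1 / 12 * (inner ℝ ((f₂ q - f₂ q') w w) w + inner ℝ (f₂ q' (w - w') w) w
          + inner ℝ (f₂ q' w' (w - w')) w + inner ℝ (f₂ q' w' w') (w - w'))
        + 1 / 4 * (inner ℝ ((f₁ q - f₁ q') w) (W (f q)) + inner ℝ (f₁ q' (w - w')) (W (f q))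
          + inner ℝ (f₁ q' w') (W (f q - f q'))) := by
    simp only [errorDensity, map_sub, inner_sub_left, inner_sub_right, FunLike.coe_sub,
      Pi.sub_apply]
    ring
  have e1 : 0 ≤ L ^ 3 * S ^ 3 * d := by positivity
  have e2 : 0 ≤ L ^ 3 * S ^ 3 * δ := by positivity
  rw [key]
  rw [abs_le] at a1 a2 a3 a4 b1 b2 b3 ⊢
  rw [mul_add]
  constructor <;> linarith

end errorDensity

/-! ### Local energy error -/

/-- The change of energy in one leapfrog step, with its leading term. -/
theorem local_energy_error (hf : IsForceField V f f₁ f₂ L) {W : E →L[ℝ] E} (hW : ‖W‖ ≤ L)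
    (hsymm : ∀ a b, inner ℝ (W a) b = inner ℝ a (W b)) {q p : E} {R h : ℝ} (hR : 1 ≤ R)
    (hp : ‖p‖ ≤ R) (hq : ‖f q‖ ≤ R) (h0 : 0 ≤ h) (h1 : h ≤ 1) {w q₁ p₁ : E}
    (hw : w = W (p + (h / 2) • f q)) (hq₁ : q₁ = q + h • w)
    (hp₁ : p₁ = p + (h / 2) • f q + (h / 2) • f q₁) :
    |(1 / 2 * inner ℝ p₁ (W p₁) + V q₁) - (1 / 2 * inner ℝ p (W p) + V q)
      - h ^ 3 * errorDensity W f f₁ f₂ q w| ≤ 18 * L ^ 5 * R ^ 4 * h ^ 4 := by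
  have hL := hf.one_le
  have hL0 := hf.nonneg
  have hwn : ‖w‖ ≤ 2 * L * R := by
    have : ‖p + (h / 2) • f q‖ ≤ 2 * R := by
      refine (norm_add_le _ _).trans ?_
      rw [norm_smul, Real.norm_eq_abs, abs_of_nonneg (by positivity)]
      nlinarith [norm_nonneg (f q)]
    rw [hw]
    exact (norm_velocity_le hW _ this).trans (le_of_eq (by ring))
  have han : ‖h • w‖ ≤ h * (2 * L * R) := by
    rw [norm_smul, Real.norm_eq_abs, abs_of_nonneg h0]
    gcongr
  set a := h • w with ha
  have t1 := hf.trapezoid q a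
  rw [← hq₁] at t1
  have t1' : L * ‖a‖ ^ 4 ≤ 16 * L ^ 5 * R ^ 4 * h ^ 4 := by
    calc L * ‖a‖ ^ 4 ≤ L * (h * (2 * L * R)) ^ 4 := by gcongr
      _ = _ := by ring
  set b := f q₁ - f q - f₁ q a with hb
  have t2 : |inner ℝ b (W (f q))| ≤ (L * (h * (2 * L * R)) ^ 2) * (L * R) := by
    refine (abs_real_inner_le_norm _ _).trans ?_
    gcongr
    · have := hf.taylor_one q a
      rw [← hq₁] at this
      refine this.trans ?_
      gcongr
    · exact norm_velocity_le hW _ hq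
  have hd : ‖f q₁ - f q‖ ≤ L * (h * (2 * L * R)) := by
    refine (hf.norm_force_sub_le q₁ q).trans ?_
    rw [hq₁, add_sub_cancel_left]
    gcongr
  have t3 : |inner ℝ (f q₁ - f q) (W (f q₁ - f q))|
      ≤ (L * (h * (2 * L * R))) * (L * (L * (h * (2 * L * R)))) := by
    refine (abs_real_inner_le_norm _ _).trans ?_
    gcongr
    exact norm_velocity_le hW _ hd
  have hLR : L ^ 4 * R ^ 3 ≤ L ^ 5 * R ^ 4 := by gcongr <;> norm_num
  have hLR' : L ^ 5 * R ^ 2 ≤ L ^ 5 * R ^ 4 := by gcongr; norm_num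
  -- The kinetic energy gains `⟨f q + f q₁, a⟩ / 2` plus `h² / 8` times `⟨f q₁, W (f q₁)⟩ - ⟨f q, W
  -- (f q)⟩`. The first part completes the trapezoidal rule. Expanding the second about `f q`, with
  -- `f q₁ - f q = h • f₁ q w + b`, yields the coefficient `1 / 4` of the density.
  have key : (1 / 2 * inner ℝ p₁ (W p₁) + V q₁) - (1 / 2 * inner ℝ p (W p) + V q)
      - h ^ 3 * errorDensity W f f₁ f₂ q w
      = (V q₁ - V q + 1 / 2 * inner ℝ (f q + f q₁) a - 1 / 12 * inner ℝ (f₂ q a a) a)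
        + h ^ 2 / 8 * (2 * inner ℝ b (W (f q)) + inner ℝ (f q₁ - f q) (W (f q₁ - f q))) := by
    have s1 : inner ℝ (f q) (W p) = inner ℝ p (W (f q)) := by
      rw [← hsymm, real_inner_comm]
    have s2 : inner ℝ (f q₁) (W p) = inner ℝ p (W (f q₁)) := by
      rw [← hsymm, real_inner_comm]
    have s3 : inner ℝ (f q₁) (W (f q)) = inner ℝ (f q) (W (f q₁)) := by
      rw [← hsymm, real_inner_comm]
    have e1 : inner ℝ (f q + f q₁) a = h * (inner ℝ p (W (f q)) + inner ℝ p (W (f q₁)))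
        + h ^ 2 / 2 * (inner ℝ (f q) (W (f q)) + inner ℝ (f q) (W (f q₁))) := by
      rw [ha, hw]
      simp only [map_add, map_smul, inner_add_left, inner_add_right, real_inner_smul_right, s1, s2,
        s3]
      ring
    have e2 : inner ℝ (f₂ q a a) a = h ^ 3 * inner ℝ (f₂ q w w) w := by
      rw [ha]
      simp only [map_smul, FunLike.coe_smul, Pi.smul_apply, real_inner_smul_left,
        real_inner_smul_right]
      ring
    have e3 : inner ℝ p₁ (W p₁) = inner ℝ p (W p) + h * (inner ℝ p (W (f q)) + inner ℝ p (W (f q₁)))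
        + h ^ 2 / 4 * (inner ℝ (f q) (W (f q)) + 2 * inner ℝ (f q) (W (f q₁))
          + inner ℝ (f q₁) (W (f q₁))) := by
      rw [hp₁]
      simp only [map_add, map_smul, inner_add_left, inner_add_right, real_inner_smul_right,
        real_inner_smul_left, s1, s2, s3]
      ring
    have e4 : inner ℝ b (W (f q)) = inner ℝ (f q) (W (f q₁)) - inner ℝ (f q) (W (f q))
        - h * inner ℝ (f₁ q w) (W (f q)) := by
      rw [hb, ha]
      simp only [map_smul, inner_sub_left, real_inner_smul_left, s3]
    have e5 : inner ℝ (f q₁ - f q) (W (f q₁ - f q)) = inner ℝ (f q₁) (W (f q₁))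
        - 2 * inner ℝ (f q) (W (f q₁)) + inner ℝ (f q) (W (f q)) := by
      simp only [map_sub, inner_sub_left, inner_sub_right, s3]
      ring
    rw [e1, e2, e3, e4, e5, errorDensity]
    ring
  rw [key]
  have hh : 0 ≤ h ^ 4 := by positivity
  have u1 : |h ^ 2 / 8 * (2 * inner ℝ b (W (f q)) + inner ℝ (f q₁ - f q) (W (f q₁ - f q)))|
      ≤ h ^ 2 / 8 * (2 * ((L * (h * (2 * L * R)) ^ 2) * (L * R))
        + (L * (h * (2 * L * R))) * (L * (L * (h * (2 * L * R))))) := by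
    rw [abs_mul, abs_of_nonneg (by positivity : 0 ≤ h ^ 2 / 8)]
    refine mul_le_mul_of_nonneg_left ((abs_add_le _ _).trans (add_le_add ?_ t3)) (by positivity)
    rw [abs_mul, abs_two]
    linarith
  have u2 : h ^ 2 / 8 * (2 * ((L * (h * (2 * L * R)) ^ 2) * (L * R))
        + (L * (h * (2 * L * R))) * (L * (L * (h * (2 * L * R)))))
      = h ^ 4 * (L ^ 4 * R ^ 3 + L ^ 5 * R ^ 2 / 2) := by ring
  have u3 : h ^ 4 * (L ^ 4 * R ^ 3 + L ^ 5 * R ^ 2 / 2) ≤ h ^ 4 * (2 * (L ^ 5 * R ^ 4)) := by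
    gcongr
    have : 0 ≤ L ^ 5 * R ^ 2 := by positivity
    linarith
  refine (abs_add_le _ _).trans ?_
  linarith

end IsForceField

/-! ### Control of the force and first-order convergence -/

/-- Mean value inequality for a curve whose derivative stays close to a fixed vector. -/
theorem norm_sub_sub_smul_le {F : Type*} [NormedAddCommGroup F] [NormedSpace ℝ F] {γ γ' : ℝ → F}
    (hγ : ∀ t, HasDerivAt γ (γ' t) t) {a b C : ℝ} (hab : a ≤ b) (c : F)
    (hC : ∀ t ∈ Icc a b, ‖γ' t - c‖ ≤ C) : ‖γ b - γ a - (b - a) • c‖ ≤ C * (b - a) := by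
  have h := norm_image_sub_le_of_norm_deriv_le_segment' (a := a) (b := b)
    (f := fun s => γ s - s • c) (f' := fun s => γ' s - c) (C := C) ?_ ?_ b (right_mem_Icc.2 hab)
  · convert h using 2
    rw [sub_smul]
    abel
  · intro s _
    have := (hγ s).fun_sub ((hasDerivAt_id s).smul_const c)
    simpa using this.hasDerivWithinAt
  · exact fun s hs => hC s (Ico_subset_Icc_self hs)

theorem norm_sub_le_of_deriv {F : Type*} [NormedAddCommGroup F] [NormedSpace ℝ F] {γ γ' : ℝ → F}
    (hγ : ∀ t, HasDerivAt γ (γ' t) t) {a b C : ℝ} (hab : a ≤ b)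
    (hC : ∀ t ∈ Icc a b, ‖γ' t‖ ≤ C) : ‖γ b - γ a‖ ≤ C * (b - a) := by
  simpa using norm_sub_sub_smul_le hγ hab (0 : F) (by simpa using hC)

namespace IsForceField

variable {V : E → ℝ} {f : E → E} {f₁ : E → E →L[ℝ] E} {f₂ : E → E →L[ℝ] E →L[ℝ] E} {L : ℝ}
  {W : E →L[ℝ] E} {q p : ℝ → E} {T : ℝ}

/-- Along a trajectory on `[0, T]` the force is controlled by the momentum. -/
theorem norm_force_le (hf : IsForceField V f f₁ f₂ L) (hW : ‖W‖ ≤ L)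
    (hq : ∀ t, HasDerivAt q (W (p t)) t) (hp : ∀ t, HasDerivAt p (f (q t)) t)
    (hT : T ≤ L) (hT2 : 2 ≤ L * T) {P : ℝ} (hP : ∀ t ∈ Icc 0 T, ‖p t‖ ≤ P) {t : ℝ}
    (ht : t ∈ Icc 0 T) : ‖f (q t)‖ ≤ 2 * L ^ 3 * P := by
  have hL := hf.one_le
  have hL0 := hf.nonneg
  have hT0 : 0 < T := by
    by_contra h
    nlinarith
  have hP0 : 0 ≤ P := (norm_nonneg _).trans (hP t ht)
  have hqd : ∀ a ∈ Icc 0 T, ∀ b ∈ Icc 0 T, a ≤ b → ‖q b - q a‖ ≤ L * P * T := by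
    intro a ha b hb hab
    refine (norm_sub_le_of_deriv hq hab (C := L * P) fun s hs => ?_).trans ?_
    · exact norm_velocity_le hW _ (hP s ⟨ha.1.trans hs.1, hs.2.trans hb.2⟩)
    · have : b - a ≤ T := by linarith [ha.1, hb.2]
      gcongr
  have hfd : ∀ s ∈ Icc 0 T, ‖f (q s) - f (q t)‖ ≤ L * (L * P * T) := by
    intro s hs
    refine (hf.norm_force_sub_le _ _).trans (mul_le_mul_of_nonneg_left ?_ hL0)
    rcases le_total s t with h | h
    · rw [norm_sub_rev]; exact hqd s hs t ht h
    · exact hqd t ht s hs h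
  -- `T • f (q t)` differs from `p T - p 0`, of norm at most `2 * P`, only by the variation of the
  -- force; `2 ≤ L * T` then allows division by `T`.
  have h1 := norm_sub_sub_smul_le hp hT0.le (f (q t)) hfd
  have h2 : ‖(T - 0) • f (q t)‖ ≤ ‖p T - p 0‖ + ‖p T - p 0 - (T - 0) • f (q t)‖ := by
    have := norm_sub_le (p T - p 0) (p T - p 0 - (T - 0) • f (q t))
    rwa [sub_sub_cancel] at this
  have h3 : ‖p T - p 0‖ ≤ P + P := (norm_sub_le _ _).trans
    (add_le_add (hP T ⟨hT0.le, le_rfl⟩) (hP 0 ⟨le_rfl, hT0.le⟩))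
  rw [norm_smul, sub_zero, Real.norm_eq_abs, abs_of_pos hT0] at h2
  rw [sub_zero] at h1
  have h4 : T * ‖f (q t)‖ ≤ T * (2 * L ^ 3 * P) := by
    calc T * ‖f (q t)‖ ≤ 2 * P + L * (L * P * T) * T := by linarith
      _ ≤ L * T * P + L * (L * P * T) * L := by gcongr
      _ = T * (L * P + L ^ 3 * P) := by ring
      _ ≤ T * (L ^ 3 * P + L ^ 3 * P) := by
        gcongr
        exact le_self_pow₀ hL (by norm_num)
      _ = T * (2 * L ^ 3 * P) := by ring
  exact le_of_mul_le_mul_left h4 hT0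

/-- First-order convergence of one leapfrog step: propagation of the global error. -/
theorem global_error_succ (hf : IsForceField V f f₁ f₂ L) (hW : ‖W‖ ≤ L)
    (hq : ∀ t, HasDerivAt q (W (p t)) t) (hp : ∀ t, HasDerivAt p (f (q t)) t)
    {R h t : ℝ} (hR : 0 ≤ R) (h0 : 0 ≤ h) (h1 : h ≤ 1)
    (hpR : ∀ s ∈ Icc t (t + h), ‖p s‖ ≤ R) (hfR : ∀ s ∈ Icc t (t + h), ‖f (q s)‖ ≤ R)
    {q₀ p₀ q₁ p₁ : E} (hq₁ : q₁ = q₀ + h • W (p₀ + (h / 2) • f q₀))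
    (hp₁ : p₁ = p₀ + (h / 2) • f q₀ + (h / 2) • f q₁) :
    ‖q₁ - q (t + h)‖ + ‖p₁ - p (t + h)‖
      ≤ (1 + 2 * L ^ 3 * h) * (‖q₀ - q t‖ + ‖p₀ - p t‖) + 4 * L ^ 3 * R * h ^ 2 := by
  have hL := hf.one_le
  have hL0 := hf.nonneg
  have hth : t ≤ t + h := by linarith
  have htm : t ∈ Icc t (t + h) := ⟨le_rfl, hth⟩
  set x := ‖q₀ - q t‖ with hx
  set y := ‖p₀ - p t‖ with hy
  have hx0 : 0 ≤ x := norm_nonneg _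
  have hy0 : 0 ≤ y := norm_nonneg _
  have hsub : ∀ s ∈ Icc t (t + h), Icc t s ⊆ Icc t (t + h) := fun s hs =>
    Icc_subset_Icc_right hs.2
  have hqt : ∀ s ∈ Icc t (t + h), ‖q s - q t‖ ≤ L * R * h := by
    intro s hs
    refine (norm_sub_le_of_deriv hq hs.1 (C := L * R) fun r hr =>
      norm_velocity_le hW _ (hpR r (hsub s hs hr))).trans ?_
    have : s - t ≤ h := by linarith [hs.2]
    gcongr
  have hpt : ∀ s ∈ Icc t (t + h), ‖p s - p t‖ ≤ R * h := by
    intro s hs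
    refine (norm_sub_le_of_deriv hp hs.1 (C := R) fun r hr => hfR r (hsub s hs hr)).trans ?_
    have : s - t ≤ h := by linarith [hs.2]
    gcongr
  -- The exact flow and the leapfrog step are both compared with an explicit Euler step.
  have d1 : ‖q (t + h) - q t - h • W (p t)‖ ≤ L * (R * h) * h := by
    have := norm_sub_sub_smul_le hq hth (W (p t)) (C := L * (R * h)) fun s hs => by
      rw [← map_sub]; exact norm_velocity_le hW _ (hpt s hs)
    rwa [add_sub_cancel_left] at this
  have d2 : ‖p (t + h) - p t - h • f (q t)‖ ≤ L * (L * R * h) * h := by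
    have := norm_sub_sub_smul_le hp hth (f (q t)) (C := L * (L * R * h)) fun s hs =>
      (hf.norm_force_sub_le _ _).trans (mul_le_mul_of_nonneg_left (hqt s hs) hL0)
    rwa [add_sub_cancel_left] at this
  -- No a priori bound on the numerical state is available: its size is bounded by that of the
  -- trajectory plus the current error.
  have hf0 : ‖f q₀‖ ≤ R + L * x := by
    have := norm_add_le (f (q t)) (f q₀ - f (q t))
    rw [add_sub_cancel] at this
    linarith [hfR t htm, hf.norm_force_sub_le q₀ (q t)]
  have hp0 : ‖p₀‖ ≤ R + y := by
    have := norm_add_le (p t) (p₀ - p t)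
    rw [add_sub_cancel] at this
    linarith [hpR t htm]
  have hw : ‖p₀ + (h / 2) • f q₀‖ ≤ 2 * R + y + L * x := by
    refine (norm_add_le _ _).trans ?_
    rw [norm_smul, Real.norm_eq_abs, abs_of_nonneg (by positivity)]
    have : h / 2 * ‖f q₀‖ ≤ 1 * (R + L * x) := by
      gcongr
      linarith
    linarith
  have hff : ‖f q₁ - f q₀‖ ≤ L * (h * (L * (2 * R + y + L * x))) := by
    refine (hf.norm_force_sub_le _ _).trans ?_
    rw [hq₁, add_sub_cancel_left, norm_smul, Real.norm_eq_abs, abs_of_nonneg h0]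
    gcongr
    exact norm_velocity_le hW _ hw
  have e1 : ‖q₁ - q (t + h)‖
      ≤ x + h * (L * y) + h * (h / 2 * (L * (R + L * x))) + L * (R * h) * h := by
    have : q₁ - q (t + h) = (q₀ - q t) + h • W (p₀ - p t) + h • ((h / 2) • W (f q₀))
        - (q (t + h) - q t - h • W (p t)) := by
      rw [hq₁]
      simp only [map_add, map_sub, map_smul, smul_add, smul_sub]
      abel
    rw [this]
    refine (norm_sub_le _ _).trans (add_le_add ((norm_add_le _ _).trans (add_le_add
      ((norm_add_le _ _).trans (add_le_add le_rfl ?_)) ?_)) d1)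
    · rw [norm_smul, Real.norm_eq_abs, abs_of_nonneg h0]
      gcongr
      exact norm_velocity_le hW _ le_rfl
    · rw [norm_smul, norm_smul, Real.norm_eq_abs, Real.norm_eq_abs, abs_of_nonneg h0,
        abs_of_nonneg (by positivity)]
      gcongr
      exact norm_velocity_le hW _ hf0
  have e2 : ‖p₁ - p (t + h)‖ ≤ y + h * (L * x) + h / 2 * (L * (h * (L * (2 * R + y + L * x))))
      + L * (L * R * h) * h := by
    have : p₁ - p (t + h) = (p₀ - p t) + h • (f q₀ - f (q t)) + (h / 2) • (f q₁ - f q₀)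
        - (p (t + h) - p t - h • f (q t)) := by
      rw [hp₁]
      have : h • f q₀ = (h / 2) • f q₀ + (h / 2) • f q₀ := by rw [← add_smul, add_halves]
      simp only [smul_sub, this]
      abel
    rw [this]
    refine (norm_sub_le _ _).trans (add_le_add ((norm_add_le _ _).trans (add_le_add
      ((norm_add_le _ _).trans (add_le_add le_rfl ?_)) ?_)) d2)
    · rw [norm_smul, Real.norm_eq_abs, abs_of_nonneg h0]
      gcongr
      exact hf.norm_force_sub_le _ _
    · rw [norm_smul, Real.norm_eq_abs, abs_of_nonneg (by positivity)]
      gcongr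
  have hL13 : L ≤ L ^ 3 := le_self_pow₀ hL (by norm_num)
  have hL23 : L ^ 2 ≤ L ^ 3 := pow_le_pow_right₀ hL (by norm_num)
  have hh2 : h ^ 2 ≤ h := by nlinarith
  have k1 : L * h ≤ L ^ 3 * h := by gcongr
  have k2 : L ^ 2 * h ^ 2 ≤ L ^ 3 * h := by gcongr
  have k3 : L ^ 3 * h ^ 2 ≤ L ^ 3 * h := by gcongr
  have k4 : L * (R * h ^ 2) ≤ L ^ 3 * (R * h ^ 2) := by gcongr
  have k5 : L ^ 2 * (R * h ^ 2) ≤ L ^ 3 * (R * h ^ 2) := by gcongr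
  have cx : (h * L + h ^ 2 / 2 * L ^ 2 + h ^ 2 / 2 * L ^ 3) * x ≤ (2 * L ^ 3 * h) * x := by
    gcongr; linarith
  have cy : (h * L + h ^ 2 / 2 * L ^ 2) * y ≤ (2 * L ^ 3 * h) * y := by
    gcongr
    have : 0 ≤ L ^ 3 * h := by positivity
    linarith
  have k6 : 0 ≤ L ^ 3 * (R * h ^ 2) := by positivity
  linarith

/-- First-order convergence of the leapfrog scheme, with an error proportional to the size of the
momentum and of the force along the trajectory. -/
theorem global_error (hf : IsForceField V f f₁ f₂ L) (hW : ‖W‖ ≤ L)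
    (hq : ∀ t, HasDerivAt q (W (p t)) t) (hp : ∀ t, HasDerivAt p (f (q t)) t)
    {R h : ℝ} (hR : 0 ≤ R) (h0 : 0 ≤ h) (h1 : h ≤ 1) (hT : T ≤ L)
    (hpR : ∀ s ∈ Icc 0 T, ‖p s‖ ≤ R) (hfR : ∀ s ∈ Icc 0 T, ‖f (q s)‖ ≤ R)
    {Q Z : ℕ → E} (hQ0 : Q 0 = q 0) (hZ0 : Z 0 = p 0)
    (hQ : ∀ n, Q (n + 1) = Q n + h • W (Z n + (h / 2) • f (Q n)))
    (hZ : ∀ n, Z (n + 1) = Z n + (h / 2) • f (Q n) + (h / 2) • f (Q (n + 1)))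
    (n : ℕ) (hn : n * h ≤ T) :
    ‖Q n - q (n * h)‖ + ‖Z n - p (n * h)‖ ≤ 2 * exp (2 * L ^ 4) * R * h := by
  have hL0 := hf.nonneg
  -- Since `4 * L ^ 3 * R * h ^ 2` is `2 * R * h` times `2 * L ^ 3 * h`, this closed form solves the
  -- error recursion exactly.
  have key : ∀ n : ℕ, n * h ≤ T → ‖Q n - q (n * h)‖ + ‖Z n - p (n * h)‖
      ≤ 2 * R * h * ((1 + 2 * L ^ 3 * h) ^ n - 1) := by
    intro n
    induction n with
    | zero => intro _; simp [hQ0, hZ0]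
    | succ n ih =>
      intro hn
      push_cast at hn ⊢
      rw [add_mul, one_mul] at hn ⊢
      have hsub : Icc (n * h) (n * h + h) ⊆ Icc 0 T :=
        Icc_subset_Icc (by positivity) hn
      have h2 := hf.global_error_succ hW hq hp hR h0 h1 (fun s hs => hpR s (hsub hs))
        (fun s hs => hfR s (hsub hs)) (hQ n) (hZ n)
      have h3 := mul_le_mul_of_nonneg_left (ih (by linarith))
        (by positivity : 0 ≤ 1 + 2 * L ^ 3 * h)
      refine h2.trans ((add_le_add h3 le_rfl).trans (le_of_eq ?_))
      ring
  refine (key n hn).trans ?_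
  have h2 : (1 + 2 * L ^ 3 * h) ^ n ≤ exp (2 * L ^ 4) := by
    calc (1 + 2 * L ^ 3 * h) ^ n ≤ exp (2 * L ^ 3 * h) ^ n := by
          gcongr
          linarith [add_one_le_exp (2 * L ^ 3 * h)]
      _ = exp (2 * L ^ 3 * (n * h)) := by rw [← exp_nat_mul]; ring_nf
      _ ≤ exp (2 * L ^ 3 * L) := by gcongr; linarith
      _ = exp (2 * L ^ 4) := by ring_nf
  calc 2 * R * h * ((1 + 2 * L ^ 3 * h) ^ n - 1) ≤ 2 * R * h * exp (2 * L ^ 4) := by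
        gcongr; linarith
    _ = _ := by ring

/-! ### Accumulation of the energy error -/

/-- The energy change over one step of a leapfrog path that follows a trajectory, compared with the
increment of the primitive `A` of the error density along the trajectory. -/
theorem energy_increment (hf : IsForceField V f f₁ f₂ L) (hW : ‖W‖ ≤ L)
    (hsymm : ∀ a b, inner ℝ (W a) b = inner ℝ a (W b))
    (hq : ∀ t, HasDerivAt q (W (p t)) t) (hp : ∀ t, HasDerivAt p (f (q t)) t)
    {A : ℝ → ℝ} (hA : ∀ t, HasDerivAt A (errorDensity W f f₁ f₂ (q t) (W (p t))) t)
    {R G h t : ℝ} (hR : 1 ≤ R) (hG : 1 ≤ G) (h0 : 0 ≤ h) (h1 : h ≤ 1)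
    (hpR : ∀ s ∈ Icc t (t + h), ‖p s‖ ≤ R) (hfR : ∀ s ∈ Icc t (t + h), ‖f (q s)‖ ≤ R)
    {q₀ p₀ q₁ p₁ : E} (hq₁ : q₁ = q₀ + h • W (p₀ + (h / 2) • f q₀))
    (hp₁ : p₁ = p₀ + (h / 2) • f q₀ + (h / 2) • f q₁)
    (herr : ‖q₀ - q t‖ + ‖p₀ - p t‖ ≤ 2 * G * R * h) :
    |(1 / 2 * inner ℝ p₁ (W p₁) + V q₁) - (1 / 2 * inner ℝ p₀ (W p₀) + V q₀)
      - h ^ 2 * (A (t + h) - A t)| ≤ 3200 * L ^ 11 * G ^ 4 * R ^ 4 * h ^ 4 := by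
  have hL := hf.one_le
  have hL0 := hf.nonneg
  have hth : t ≤ t + h := by linarith
  have htm : t ∈ Icc t (t + h) := ⟨le_rfl, hth⟩
  have hR0 : 0 ≤ R := by linarith
  have hG0 : 0 ≤ G := by linarith
  have hx : ‖q₀ - q t‖ ≤ 2 * G * R * h := by linarith [norm_nonneg (p₀ - p t)]
  have hy : ‖p₀ - p t‖ ≤ 2 * G * R * h := by linarith [norm_nonneg (q₀ - q t)]
  have hGR : R ≤ G * R := le_mul_of_one_le_left hR0 hG
  have hLG : G * R ≤ L * (G * R) := le_mul_of_one_le_left (by positivity) hL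
  have hLLG : L * (G * R) ≤ L * (L * (G * R)) := le_mul_of_one_le_left (by positivity) hL
  have hGh : 2 * G * R * h ≤ 2 * (G * R) := by
    calc 2 * G * R * h ≤ 2 * G * R * 1 := by gcongr
      _ = _ := by ring
  have hp0 : ‖p₀‖ ≤ 3 * L * G * R := by
    have := norm_add_le (p t) (p₀ - p t)
    rw [add_sub_cancel] at this
    linarith [hpR t htm]
  have hf0 : ‖f q₀‖ ≤ 3 * L * G * R := by
    have := norm_add_le (f (q t)) (f q₀ - f (q t))
    rw [add_sub_cancel] at this
    have h2 : ‖f q₀ - f (q t)‖ ≤ L * (2 * (G * R)) := (hf.norm_force_sub_le _ _).trans (by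
      gcongr; exact hx.trans hGh)
    linarith [hfR t htm]
  have hR1 : 1 ≤ 3 * L * G * R := by linarith
  set w := W (p₀ + (h / 2) • f q₀) with hw
  have l1 := hf.local_energy_error hW hsymm hR1 hp0 hf0 h0 h1 hw hq₁ hp₁
  have hwS : ‖w‖ ≤ 6 * L ^ 2 * G * R := by
    have : ‖p₀ + (h / 2) • f q₀‖ ≤ 2 * (3 * L * G * R) := by
      refine (norm_add_le _ _).trans ?_
      rw [norm_smul, Real.norm_eq_abs, abs_of_nonneg (by positivity)]
      have : h / 2 * ‖f q₀‖ ≤ 1 * (3 * L * G * R) := by gcongr; linarith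
      linarith
    exact (norm_velocity_le hW _ this).trans (le_of_eq (by ring))
  have hS : 1 ≤ 6 * L ^ 2 * G * R := by
    have : 6 * L ^ 2 * G * R = 6 * (L * (L * (G * R))) := by ring
    linarith
  -- Three displacements of order `h` add up: motion of the trajectory within the step, the global
  -- error, and the half kick in `w`. The constant is `1728 = 6 ^ 3 * (3 + 5)`.
  have hdens : ∀ s ∈ Icc t (t + h), ‖errorDensity W f f₁ f₂ (q s) (W (p s))
      - errorDensity W f f₁ f₂ q₀ w‖ ≤ 1728 * L ^ 11 * G ^ 4 * R ^ 4 * h := by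
    intro s hs
    have hsub : Icc t s ⊆ Icc t (t + h) := Icc_subset_Icc_right hs.2
    have hst : s - t ≤ h := by linarith [hs.2]
    have hqt : ‖q s - q t‖ ≤ L * R * h := by
      refine (norm_sub_le_of_deriv hq hs.1 (C := L * R) fun r hr =>
        norm_velocity_le hW _ (hpR r (hsub hr))).trans ?_
      gcongr
    have hpt : ‖p s - p t‖ ≤ R * h := by
      refine (norm_sub_le_of_deriv hp hs.1 (C := R) fun r hr => hfR r (hsub hr)).trans ?_
      gcongr
    have hws : ‖W (p s)‖ ≤ 6 * L ^ 2 * G * R := by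
      refine (norm_velocity_le hW _ (hpR s hs)).trans ?_
      have : L * R ≤ L * (L * (G * R)) := by gcongr; linarith
      have : 6 * L ^ 2 * G * R = 6 * (L * (L * (G * R))) := by ring
      have : 0 ≤ L * R := by positivity
      linarith
    have hfs : ‖f (q s)‖ ≤ 6 * L ^ 2 * G * R := by
      refine (hfR s hs).trans ?_
      have : 6 * L ^ 2 * G * R = 6 * (L * (L * (G * R))) := by ring
      linarith
    have d1 : ‖q s - q₀‖ ≤ 3 * L ^ 2 * G * R * h := by
      have h2 : ‖q s - q₀‖ ≤ ‖q s - q t‖ + ‖q₀ - q t‖ := by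
        have := norm_sub_le (q s - q t) (q₀ - q t)
        rwa [sub_sub_sub_cancel_right] at this
      have h3 : L * R * h + 2 * G * R * h ≤ 3 * L ^ 2 * G * R * h := by
        have : L * R ≤ L * (L * (G * R)) := by gcongr; linarith
        have : (L * R + 2 * (G * R)) * h ≤ (3 * (L * (L * (G * R)))) * h := by
          gcongr; linarith
        linarith
      linarith
    have d2 : ‖W (p s) - w‖ ≤ 5 * L ^ 2 * G * R * h := by
      have h2 : ‖p s - (p₀ + (h / 2) • f q₀)‖ ≤ R * h + 2 * G * R * h + h / 2 * (3 * L * G * R) := by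
        have : p s - (p₀ + (h / 2) • f q₀) = (p s - p t) - (p₀ - p t) - (h / 2) • f q₀ := by abel
        rw [this]
        refine (norm_sub_le _ _).trans (add_le_add ((norm_sub_le _ _).trans
          (add_le_add hpt hy)) ?_)
        rw [norm_smul, Real.norm_eq_abs, abs_of_nonneg (by positivity)]
        gcongr
      have h3 : R * h + 2 * G * R * h + h / 2 * (3 * L * G * R) ≤ 5 * (L * (G * R)) * h := by
        have : (R + 2 * (G * R) + 3 / 2 * (L * (G * R))) * h ≤ (5 * (L * (G * R))) * h := by
          gcongr; linarith
        linarith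
      rw [hw, ← map_sub]
      exact (norm_velocity_le hW _ (h2.trans h3)).trans (le_of_eq (by ring))
    refine (hf.abs_errorDensity_sub_le hW hS hws hwS hfs).trans ?_
    calc L ^ 3 * (6 * L ^ 2 * G * R) ^ 3 * (‖q s - q₀‖ + ‖W (p s) - w‖)
        ≤ L ^ 3 * (6 * L ^ 2 * G * R) ^ 3
          * (3 * L ^ 2 * G * R * h + 5 * L ^ 2 * G * R * h) := by gcongr
      _ = _ := by ring
  have l2 := norm_sub_sub_smul_le hA hth _ hdens
  rw [add_sub_cancel_left, Real.norm_eq_abs, smul_eq_mul] at l2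
  have l3 := mul_le_mul_of_nonneg_left l2 (by positivity : 0 ≤ h ^ 2)
  rw [← abs_of_nonneg (by positivity : 0 ≤ h ^ 2), ← abs_mul,
    abs_of_nonneg (by positivity : 0 ≤ h ^ 2)] at l3
  -- `18 * 3 ^ 4 = 1458`, and `1458 + 1728 ≤ 3200`.
  have l4 : 18 * L ^ 5 * (3 * L * G * R) ^ 4 * h ^ 4 ≤ 1458 * L ^ 11 * G ^ 4 * R ^ 4 * h ^ 4 := by
    calc 18 * L ^ 5 * (3 * L * G * R) ^ 4 * h ^ 4 = 1458 * L ^ 9 * G ^ 4 * R ^ 4 * h ^ 4 := by ring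
      _ ≤ _ := by gcongr; norm_num
  have l5 : 0 ≤ L ^ 11 * G ^ 4 * R ^ 4 * h ^ 4 := by positivity
  rw [abs_le] at l1 l3 ⊢
  constructor <;> linarith [l1.1, l1.2, l3.1, l3.2]

/-- The energy error of the leapfrog scheme over the time `T` to leading order. -/
theorem energy_error (hf : IsForceField V f f₁ f₂ L) (hW : ‖W‖ ≤ L)
    (hsymm : ∀ a b, inner ℝ (W a) b = inner ℝ a (W b))
    (hq : ∀ t, HasDerivAt q (W (p t)) t) (hp : ∀ t, HasDerivAt p (f (q t)) t)
    {A : ℝ → ℝ} (hA : ∀ t, HasDerivAt A (errorDensity W f f₁ f₂ (q t) (W (p t))) t)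
    (hA0 : A 0 = 0) {R h : ℝ} (hR : 1 ≤ R) (h0 : 0 < h) (h1 : h ≤ 1) (hT0 : 0 ≤ T) (hT : T ≤ L)
    (hpR : ∀ s ∈ Icc 0 T, ‖p s‖ ≤ R) (hfR : ∀ s ∈ Icc 0 T, ‖f (q s)‖ ≤ R)
    {Q Z : ℕ → E} (hQ0 : Q 0 = q 0) (hZ0 : Z 0 = p 0)
    (hQ : ∀ n, Q (n + 1) = Q n + h • W (Z n + (h / 2) • f (Q n)))
    (hZ : ∀ n, Z (n + 1) = Z n + (h / 2) • f (Q n) + (h / 2) • f (Q (n + 1))) :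
    |(1 / 2 * inner ℝ (Z ⌊T / h⌋₊) (W (Z ⌊T / h⌋₊)) + V (Q ⌊T / h⌋₊))
      - (1 / 2 * inner ℝ (p 0) (W (p 0)) + V (q 0)) - h ^ 2 * A T|
      ≤ 3201 * L ^ 12 * exp (2 * L ^ 4) ^ 4 * R ^ 4 * h ^ 3 := by
  have hL := hf.one_le
  have hL0 := hf.nonneg
  have hG : 1 ≤ exp (2 * L ^ 4) := one_le_exp (by positivity)
  set G := exp (2 * L ^ 4) with hGdef
  have hsum : ∀ n : ℕ, n * h ≤ T →
      |(1 / 2 * inner ℝ (Z n) (W (Z n)) + V (Q n))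
        - (1 / 2 * inner ℝ (p 0) (W (p 0)) + V (q 0)) - h ^ 2 * A (n * h)|
        ≤ n * (3200 * L ^ 11 * G ^ 4 * R ^ 4 * h ^ 4) := by
    intro n
    induction n with
    | zero => intro _; simp [hQ0, hZ0, hA0]
    | succ n ih =>
      intro hn
      push_cast at hn ⊢
      rw [add_mul, one_mul] at hn ⊢
      have hn' : n * h ≤ T := by linarith
      have hsub : Icc (n * h) (n * h + h) ⊆ Icc 0 T :=
        Icc_subset_Icc (by positivity) hn
      have i1 := hf.energy_increment hW hsymm hq hp hA hR hG h0.le h1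
        (fun s hs => hpR s (hsub hs)) (fun s hs => hfR s (hsub hs)) (hQ n) (hZ n)
        (hf.global_error hW hq hp (by linarith) h0.le h1 hT hpR hfR hQ0 hZ0 hQ hZ n hn')
      have i2 := ih hn'
      rw [abs_le] at i1 i2 ⊢
      constructor <;> linarith [i1.1, i1.2, i2.1, i2.2]
  have hN : (⌊T / h⌋₊ : ℝ) * h ≤ T := by
    have := Nat.floor_le (div_nonneg hT0 h0.le)
    rwa [le_div_iff₀ h0] at this
  have hN' : T - ⌊T / h⌋₊ * h ≤ h := by
    have := Nat.lt_floor_add_one (T / h)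
    rw [div_lt_iff₀ h0] at this
    linarith
  have s1 := hsum _ hN
  set N := ⌊T / h⌋₊
  have hLR : 1 ≤ L * R := one_le_mul_of_one_le_of_one_le hL hR
  -- The scheme stops at `N * h`, less than one step short of `T`; after multiplication by `h ^ 2`
  -- the missing piece is again of order `h ^ 3`. The size `L * R` bounds velocity and force alike.
  have s2 : |A T - A (N * h)| ≤ L ^ 2 * (L * R) ^ 3 * h := by
    refine (norm_sub_le_of_deriv hA hN (C := L ^ 2 * (L * R) ^ 3) fun s hs => ?_).trans ?_
    · have hsT : s ∈ Icc 0 T := ⟨le_trans (by positivity) hs.1, hs.2⟩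
      exact hf.abs_errorDensity_le hW hLR (norm_velocity_le hW _ (hpR s hsT))
        ((hfR s hsT).trans (le_mul_of_one_le_left (by linarith) hL))
    · gcongr
  have s3 : (N : ℝ) * (3200 * L ^ 11 * G ^ 4 * R ^ 4 * h ^ 4)
      ≤ 3200 * L ^ 12 * G ^ 4 * R ^ 4 * h ^ 3 := by
    calc (N : ℝ) * (3200 * L ^ 11 * G ^ 4 * R ^ 4 * h ^ 4)
        = (N * h) * (3200 * L ^ 11 * G ^ 4 * R ^ 4 * h ^ 3) := by ring
      _ ≤ L * (3200 * L ^ 11 * G ^ 4 * R ^ 4 * h ^ 3) := by gcongr; linarith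
      _ = _ := by ring
  have s4 : L ^ 2 * (L * R) ^ 3 * h ≤ L ^ 12 * G ^ 4 * R ^ 4 * h := by
    calc L ^ 2 * (L * R) ^ 3 * h = L ^ 5 * 1 * R ^ 3 * h := by ring
      _ ≤ L ^ 12 * G ^ 4 * R ^ 4 * h := by
        gcongr
        · norm_num
        · exact one_le_pow₀ hG
        · norm_num
  have s5 := mul_le_mul_of_nonneg_left (s2.trans s4) (by positivity : 0 ≤ h ^ 2)
  rw [← abs_of_nonneg (by positivity : 0 ≤ h ^ 2), ← abs_mul,
    abs_of_nonneg (by positivity : 0 ≤ h ^ 2)] at s5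
  rw [abs_le] at s1 s5 ⊢
  constructor <;> linarith [s1.1, s1.2, s5.1, s5.2]

/-- The primitive of the error density along a trajectory is bounded by the cube of the size of the
trajectory. -/
theorem abs_primitive_le (hf : IsForceField V f f₁ f₂ L) (hW : ‖W‖ ≤ L)
    {A : ℝ → ℝ} (hA : ∀ t, HasDerivAt A (errorDensity W f f₁ f₂ (q t) (W (p t))) t)
    (hA0 : A 0 = 0) {R : ℝ} (hR : 1 ≤ R) (hT0 : 0 ≤ T) (hT : T ≤ L)
    (hpR : ∀ s ∈ Icc 0 T, ‖p s‖ ≤ R) (hfR : ∀ s ∈ Icc 0 T, ‖f (q s)‖ ≤ R) :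
    |A T| ≤ L ^ 6 * R ^ 3 := by
  have hL := hf.one_le
  have hL0 := hf.nonneg
  have hLR : 1 ≤ L * R := one_le_mul_of_one_le_of_one_le hL hR
  have h := norm_sub_le_of_deriv hA hT0 (C := L ^ 2 * (L * R) ^ 3) fun s hs =>
    hf.abs_errorDensity_le hW hLR (norm_velocity_le hW _ (hpR s hs))
      ((hfR s hs).trans (le_mul_of_one_le_left (by linarith) hL))
  rw [hA0, sub_zero, sub_zero, Real.norm_eq_abs] at h
  calc |A T| ≤ L ^ 2 * (L * R) ^ 3 * T := h
    _ ≤ L ^ 2 * (L * R) ^ 3 * L := by gcongr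
    _ = _ := by ring

end IsForceField

/-! ### Admissible potentials as force fields -/

theorem AdmissiblePotential.contDiff_force {m : ℕ} {V : Vec m → ℝ} {B : ℝ}
    (hV : AdmissiblePotential V B) : ContDiff ℝ 3 (force V) := by
  have h : ContDiff ℝ 3 (fderiv ℝ V) := hV.contDiff.fderiv_right (by norm_num)
  exact ((InnerProductSpace.toDual ℝ (Vec m)).symm.contDiff.comp h).neg

/-- An admissible potential generates a force field with Lipschitz constant any `L ≥ max 1 B`. -/
theorem AdmissiblePotential.isForceField {m : ℕ} {V : Vec m → ℝ} {B L : ℝ}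
    (hV : AdmissiblePotential V B) (hL : 1 ≤ L) (hB : B ≤ L) :
    IsForceField V (force V) (fderiv ℝ (force V)) (fderiv ℝ (fderiv ℝ (force V))) L := by
  have hc := hV.contDiff_force
  have hc₁ : ContDiff ℝ 2 (fderiv ℝ (force V)) := hc.fderiv_right (by norm_num)
  have hc₂ : ContDiff ℝ 1 (fderiv ℝ (fderiv ℝ (force V))) := hc₁.fderiv_right (by norm_num)
  have hV₁ : ContDiff ℝ 3 (fderiv ℝ V) := hV.contDiff.fderiv_right (by norm_num)
  refine ⟨hL, fun q => ?_, fun q => (hc.differentiable (by norm_num) q).hasFDerivAt,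
    fun q => (hc₁.differentiable (by norm_num) q).hasFDerivAt, fun q => ?_, fun q => ?_,
    fun q r => ?_, fun q a b => ?_⟩
  · rw [force, neg_neg]
    exact (hV.contDiff.differentiable (by norm_num) q).hasGradientAt
  · rw [← norm_iteratedFDeriv_one]
    exact (hV.bound 1 le_rfl (by norm_num) q).trans hB
  · rw [← norm_iteratedFDeriv_one, norm_iteratedFDeriv_fderiv]
    exact (hV.bound 2 (by norm_num) (by norm_num) q).trans hB
  · refine convex_univ.norm_image_sub_le_of_norm_hasFDerivWithin_le
      (fun x _ => (hc₂.differentiable (by norm_num) x).hasFDerivAt.hasFDerivWithinAt)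
      (fun x _ => ?_) (mem_univ r) (mem_univ q)
    rw [← norm_iteratedFDeriv_one, norm_iteratedFDeriv_fderiv, norm_iteratedFDeriv_fderiv]
    exact (hV.bound 3 (by norm_num) le_rfl x).trans hB
  -- Through the Riesz isomorphism, symmetry of `f'` becomes symmetry of the second derivative of
  -- `V`.
  · have hpair : ∀ x c, inner ℝ (force V x) c = -fderiv ℝ V x c := by
      intro x c
      rw [force, inner_neg_left, gradient, InnerProductSpace.toDual_symm_apply]
    have hderiv : ∀ a c, inner ℝ (fderiv ℝ (force V) q a) c = -fderiv ℝ (fderiv ℝ V) q a c := by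
      intro a c
      have h1 : HasFDerivAt (fun x => inner ℝ (force V x) c)
          ((fderivInnerCLM ℝ (force V q, c)).comp
            ((fderiv ℝ (force V) q).prod (0 : Vec m →L[ℝ] Vec m))) q :=
        (hc.differentiable (by norm_num) q).hasFDerivAt.inner ℝ (hasFDerivAt_const c q)
      have h2 : HasFDerivAt (fun x => -fderiv ℝ V x c)
          (-((fderiv ℝ (fderiv ℝ V) q).flip c)) q := by
        have := ((hV₁.differentiable (by norm_num) q).hasFDerivAt.clm_apply
          (hasFDerivAt_const c q)).fun_neg
        simpa using this
      simp only [hpair] at h1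
      have := congrArg (fun A : Vec m →L[ℝ] ℝ => A a) (h1.unique h2)
      simpa using this
    have hs : IsSymmSndFDerivAt ℝ V q := hV.contDiff.contDiffAt.isSymmSndFDerivAt (by simp; norm_num)
    rw [hderiv, real_inner_comm, hderiv, hs.eq]

theorem inner_op_inv_comm {m : ℕ} {M : Matrix (Fin m) (Fin m) ℝ} (hM : M.PosDef) (a b : Vec m) :
    inner ℝ (op M⁻¹ a) b = inner ℝ a (op M⁻¹ b) := by
  have h : (M⁻¹).IsHermitian := hM.isHermitian.inv
  have h2 : ContinuousLinearMap.adjoint (op M⁻¹) = op M⁻¹ := by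
    rw [← ContinuousLinearMap.star_eq_adjoint, op, ← map_star, Matrix.star_eq_conjTranspose, h]
  rw [← ContinuousLinearMap.adjoint_inner_right, h2]

/-! ### Trajectories and the variational system -/

section trajectory

variable {m : ℕ} {M : Matrix (Fin m) (Fin m) ℝ} {V : Vec m → ℝ} {L : ℝ}
  {f₁ : Vec m → Vec m →L[ℝ] Vec m} {f₂ : Vec m → Vec m →L[ℝ] Vec m →L[ℝ] Vec m}

theorem existsUnique_isTrajectory (hf : IsForceField V (force V) f₁ f₂ L) (hW : ‖op M⁻¹‖ ≤ L)
    (x : Vec m × Vec m) :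
    ∃! s : (ℝ → Vec m) × (ℝ → Vec m), IsTrajectory M V x s.1 s.2 := by
  have hfc : Continuous (force V) :=
    continuous_iff_continuousAt.2 fun q => (hf.hasFDerivAt q).continuousAt
  let v : ℝ → Vec m × Vec m → Vec m × Vec m := fun _ y => (op M⁻¹ y.2, force V y.1)
  have hv : Continuous (Function.uncurry v) := by
    simp only [v, Function.uncurry_def]
    fun_prop
  have hlip : ∀ t x y, ‖v t x - v t y‖ ≤ L * ‖x - y‖ := by
    intro t x y
    refine norm_prod_le_iff.2 ⟨?_, ?_⟩
    · change ‖op M⁻¹ x.2 - op M⁻¹ y.2‖ ≤ _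
      rw [← map_sub]
      exact IsForceField.norm_velocity_le hW _ (norm_snd_le (x - y))
    · exact (hf.norm_force_sub_le _ _).trans
        (mul_le_mul_of_nonneg_left (norm_fst_le (x - y)) hf.nonneg)
  obtain ⟨y, hy0, hy⟩ := exists_global_solution hv hf.nonneg hlip x
  refine ⟨(fun t => (y t).1, fun t => (y t).2), ⟨fun t => (hy t).fst, fun t => (hy t).snd, hy0⟩,
    fun s hs => ?_⟩
  have hlip' : ∀ t, LipschitzOnWith ⟨L, hf.nonneg⟩ (v t) univ := fun t =>
    (LipschitzWith.of_dist_le_mul fun x y => by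
      rw [dist_eq_norm, dist_eq_norm]; exact hlip t x y).lipschitzOnWith
  have := ODE_solution_unique_univ (t₀ := 0) (f := fun t => (s.1 t, s.2 t)) (g := y) hlip'
    (fun t => ⟨(hs.deriv_q t).prodMk (hs.deriv_p t), mem_univ _⟩)
    (fun t => ⟨hy t, mem_univ _⟩) (hs.initial.trans hy0.symm)
  rw [← this]

variable {x : Vec m × Vec m} {q p u v : ℝ → Vec m}

/-- With its analogue for `p`, this expresses the forcing of the variational system in the state,
giving its continuity and the value of the pairing's derivative. -/
theorem IsTrajectory.iteratedDeriv_three_q (hf : IsForceField V (force V) f₁ f₂ L)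
    (h : IsTrajectory M V x q p) :
    iteratedDeriv 3 q = fun t => op M⁻¹ (f₁ (q t) (op M⁻¹ (p t))) := by
  have h1 : deriv q = fun t => op M⁻¹ (p t) := funext fun t => (h.deriv_q t).deriv
  have h2 : deriv (fun t => op M⁻¹ (p t)) = fun t => op M⁻¹ (force V (q t)) :=
    funext fun t => ((op M⁻¹).hasFDerivAt.comp_hasDerivAt t (h.deriv_p t)).deriv
  have h3 : deriv (fun t => op M⁻¹ (force V (q t)))
      = fun t => op M⁻¹ (f₁ (q t) (op M⁻¹ (p t))) := funext fun t =>
    ((op M⁻¹).hasFDerivAt.comp_hasDerivAt t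
      ((hf.hasFDerivAt (q t)).comp_hasDerivAt t (h.deriv_q t))).deriv
  simp only [iteratedDeriv_succ, iteratedDeriv_zero, h1, h2, h3]

theorem IsTrajectory.iteratedDeriv_three_p (hf : IsForceField V (force V) f₁ f₂ L)
    (h : IsTrajectory M V x q p) :
    iteratedDeriv 3 p = fun t => f₂ (q t) (op M⁻¹ (p t)) (op M⁻¹ (p t))
      + f₁ (q t) (op M⁻¹ (force V (q t))) := by
  have h1 : deriv p = fun t => force V (q t) := funext fun t => (h.deriv_p t).deriv
  have h2 : deriv (fun t => force V (q t)) = fun t => f₁ (q t) (op M⁻¹ (p t)) :=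
    funext fun t => ((hf.hasFDerivAt (q t)).comp_hasDerivAt t (h.deriv_q t)).deriv
  have h3 : deriv (fun t => f₁ (q t) (op M⁻¹ (p t))) = fun t =>
      f₂ (q t) (op M⁻¹ (p t)) (op M⁻¹ (p t)) + f₁ (q t) (op M⁻¹ (force V (q t))) :=
    funext fun t => (((hf.hasFDerivAt₁ (q t)).comp_hasDerivAt t (h.deriv_q t)).clm_apply
      ((op M⁻¹).hasFDerivAt.comp_hasDerivAt t (h.deriv_p t))).deriv
  simp only [iteratedDeriv_succ, iteratedDeriv_zero, h1, h2, h3]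

theorem IsTrajectory.continuous_q (h : IsTrajectory M V x q p) : Continuous q :=
  continuous_iff_continuousAt.2 fun t => (h.deriv_q t).continuousAt

theorem IsTrajectory.continuous_p (h : IsTrajectory M V x q p) : Continuous p :=
  continuous_iff_continuousAt.2 fun t => (h.deriv_p t).continuousAt

/-- The system is affine with continuous inhomogeneity, and its linear part is bounded by `L`
because `f'` and `M⁻¹` are. -/
theorem existsUnique_isVariationalSolution
    (hf : IsForceField V (force V) (fderiv ℝ (force V)) f₂ L) (hW : ‖op M⁻¹‖ ≤ L)
    (h : IsTrajectory M V x q p) :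
    ∃! w : (ℝ → Vec m) × (ℝ → Vec m), IsVariationalSolution M V q p w.1 w.2 := by
  have hqc := h.continuous_q
  have hpc := h.continuous_p
  have hfc : Continuous (force V) :=
    continuous_iff_continuousAt.2 fun q => (hf.hasFDerivAt q).continuousAt
  have hf₁c : Continuous (fderiv ℝ (force V)) :=
    continuous_iff_continuousAt.2 fun q => (hf.hasFDerivAt₁ q).continuousAt
  have hf₂l : LipschitzWith ⟨L, hf.nonneg⟩ f₂ := LipschitzWith.of_dist_le_mul fun q r => by
    rw [dist_eq_norm, dist_eq_norm]; exact hf.lipschitz₂ q r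
  have hf₂c : Continuous f₂ := hf₂l.continuous
  have hq3 : Continuous (iteratedDeriv 3 q) := by
    rw [h.iteratedDeriv_three_q hf]
    fun_prop
  have hp3 : Continuous (iteratedDeriv 3 p) := by
    rw [h.iteratedDeriv_three_p hf]
    fun_prop
  let F : ℝ → Vec m × Vec m → Vec m × Vec m := fun t y =>
    (fderiv ℝ (force V) (q t) y.2 + (1 / 12 : ℝ) • iteratedDeriv 3 p t,
      op M⁻¹ y.1 - (1 / 6 : ℝ) • iteratedDeriv 3 q t)
  have hF : Continuous (Function.uncurry F) := by
    simp only [F, Function.uncurry_def]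
    fun_prop
  have hlip : ∀ t x y, ‖F t x - F t y‖ ≤ L * ‖x - y‖ := by
    intro t x y
    refine norm_prod_le_iff.2 ⟨?_, ?_⟩
    · change ‖fderiv ℝ (force V) (q t) x.2 + _ - (fderiv ℝ (force V) (q t) y.2 + _)‖ ≤ _
      rw [add_sub_add_right_eq_sub, ← map_sub]
      exact (fderiv ℝ (force V) (q t)).le_of_opNorm_le_of_le (hf.norm_le₁ _) (norm_snd_le (x - y))
    · change ‖op M⁻¹ x.1 - _ - (op M⁻¹ y.1 - _)‖ ≤ _
      rw [sub_sub_sub_cancel_right, ← map_sub]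
      exact IsForceField.norm_velocity_le hW _ (norm_fst_le (x - y))
  obtain ⟨y, hy0, hy⟩ := exists_global_solution hF hf.nonneg hlip 0
  refine ⟨(fun t => (y t).1, fun t => (y t).2), ⟨fun t => (hy t).fst, fun t => (hy t).snd,
    congrArg Prod.fst hy0, congrArg Prod.snd hy0⟩, fun s hs => ?_⟩
  have hlip' : ∀ t, LipschitzOnWith ⟨L, hf.nonneg⟩ (F t) univ := fun t =>
    (LipschitzWith.of_dist_le_mul fun x y => by
      rw [dist_eq_norm, dist_eq_norm]; exact hlip t x y).lipschitzOnWith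
  have := ODE_solution_unique_univ (t₀ := 0) (f := fun t => (s.1 t, s.2 t)) (g := y) hlip'
    (fun t => ⟨(hs.deriv_u t).prodMk (hs.deriv_v t), mem_univ _⟩)
    (fun t => ⟨hy t, mem_univ _⟩) ((Prod.ext hs.initial_u hs.initial_v).trans hy0.symm)
  rw [← this]

/-- The pairing of the variational solution with the differential of the energy is a primitive of
the error density. -/
theorem IsVariationalSolution.hasDerivAt_pairing
    (hf : IsForceField V (force V) (fderiv ℝ (force V)) f₂ L)
    (hsymm : ∀ a b, inner ℝ (op M⁻¹ a) b = inner ℝ a (op M⁻¹ b))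
    (h : IsTrajectory M V x q p) (hw : IsVariationalSolution M V q p u v) (t : ℝ) :
    HasDerivAt (fun t => inner ℝ (op M⁻¹ (p t)) (u t) - inner ℝ (force V (q t)) (v t))
      (errorDensity (op M⁻¹) (force V) (fderiv ℝ (force V)) f₂ (q t) (op M⁻¹ (p t))) t := by
  have h1 := ((op M⁻¹).hasFDerivAt.comp_hasDerivAt t (h.deriv_p t)).inner ℝ (hw.deriv_u t)
  have h2 := ((hf.hasFDerivAt (q t)).comp_hasDerivAt t (h.deriv_q t)).inner ℝ (hw.deriv_v t)
  -- The terms in `u` and `v` cancel by symmetry. Besides the `f₂` term, the forcing contributes the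
  -- same `f₁` expression with weights `1 / 12` from `p'''` and `1 / 6` from `q'''`, in total `1 /
  -- 4`.
  refine (h1.fun_sub h2).congr_deriv ?_
  rw [h.iteratedDeriv_three_q hf, h.iteratedDeriv_three_p hf]
  simp only [errorDensity, Function.comp_apply, inner_add_right, inner_sub_right,
    real_inner_smul_right]
  have e1 : inner ℝ (op M⁻¹ (p t)) (fderiv ℝ (force V) (q t) (v t))
      = inner ℝ (fderiv ℝ (force V) (q t) (op M⁻¹ (p t))) (v t) := (hf.symmetric _ _ _).symm
  have e2 : inner ℝ (force V (q t)) (op M⁻¹ (u t)) = inner ℝ (op M⁻¹ (force V (q t))) (u t) :=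
    (hsymm _ _).symm
  have e3 : inner ℝ (op M⁻¹ (p t)) (fderiv ℝ (force V) (q t) (op M⁻¹ (force V (q t))))
      = inner ℝ (fderiv ℝ (force V) (q t) (op M⁻¹ (p t))) (op M⁻¹ (force V (q t))) :=
    (hf.symmetric _ _ _).symm
  have e4 : inner ℝ (force V (q t)) (op M⁻¹ (fderiv ℝ (force V) (q t) (op M⁻¹ (p t))))
      = inner ℝ (fderiv ℝ (force V) (q t) (op M⁻¹ (p t))) (op M⁻¹ (force V (q t))) := by
    rw [← hsymm, real_inner_comm]
  have e5 := real_inner_comm (f₂ (q t) (op M⁻¹ (p t)) (op M⁻¹ (p t))) (op M⁻¹ (p t))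
  rw [e1, e2, e3, e4, e5]
  ring

theorem IsTrajectory.energy_eq (hf : IsForceField V (force V) f₁ f₂ L)
    (hsymm : ∀ a b, inner ℝ (op M⁻¹ a) b = inner ℝ a (op M⁻¹ b))
    (h : IsTrajectory M V x q p) (t : ℝ) : energy M V (q t, p t) = energy M V x := by
  have hd : ∀ t, HasDerivAt (fun t => energy M V (q t, p t)) 0 t := by
    intro t
    have h1 := ((h.deriv_p t).inner ℝ
      ((op M⁻¹).hasFDerivAt.comp_hasDerivAt t (h.deriv_p t))).const_mul (1 / 2 : ℝ)
    have h2 := (hf.hasGradientAt (q t)).hasFDerivAt.comp_hasDerivAt t (h.deriv_q t)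
    rw [InnerProductSpace.toDual_apply_apply, inner_neg_left] at h2
    refine (h1.fun_add h2).congr_deriv ?_
    rw [Function.comp_apply, ← hsymm (p t), real_inner_comm (op M⁻¹ (p t))]
    ring
  have := is_const_of_deriv_eq_zero (fun t => (hd t).differentiableAt) (fun t => (hd t).deriv) t 0
  rw [this, h.initial]

theorem norm_le_supNorm {T : ℝ} {g : ℝ → Vec m} (hg : Continuous g) {t : ℝ} (ht : t ∈ Icc 0 T) :
    ‖g t‖ ≤ supNorm T g := by
  -- An unbounded real supremum would default to `0`; compactness rules this out.
  have hb : BddAbove (range fun t : Icc (0 : ℝ) T => ‖g t‖) :=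
    isCompact_range (hg.norm.comp continuous_subtype_val) |>.bddAbove
  exact le_ciSup hb ⟨t, ht⟩

end trajectory


/-! ### The scheme in terms of the force, and constants -/

theorem step_fst {m : ℕ} (M : Matrix (Fin m) (Fin m) ℝ) (V : Vec m → ℝ) (h : ℝ)
    (x : Vec m × Vec m) :
    (step M V h x).1 = x.1 + h • op M⁻¹ (x.2 + (h / 2) • force V x.1) := by
  simp only [step, force, smul_neg, sub_eq_add_neg]

theorem step_snd {m : ℕ} (M : Matrix (Fin m) (Fin m) ℝ) (V : Vec m → ℝ) (h : ℝ)
    (x : Vec m × Vec m) :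
    (step M V h x).2
      = x.2 + (h / 2) • force V x.1 + (h / 2) • force V (step M V h x).1 := by
  simp only [step, force, smul_neg, sub_eq_add_neg]

/-- A common bound for all the data of the problem. -/
noncomputable def dataBound (B T w : ℝ) : ℝ := 1 + |B| + w + T + 2 / T

/-- The constant in the error estimates, in terms of the common bound of the data. -/
noncomputable def errorConstant (L : ℝ) : ℝ :=
  3201 * L ^ 12 * exp (2 * L ^ 4) ^ 4 * (256 * L ^ 12) + 64 * L ^ 15

theorem one_add_pow_three_le {P : ℝ} (hP : 0 ≤ P) : (1 + P) ^ 3 ≤ 8 * (P ^ 3 + 1) := by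
  rcases le_total P 1 with h | h
  · calc (1 + P) ^ 3 ≤ (1 + 1) ^ 3 := by gcongr
      _ ≤ 8 * (P ^ 3 + 1) := by nlinarith [pow_nonneg hP 3]
  · calc (1 + P) ^ 3 ≤ (P + P) ^ 3 := by gcongr
      _ ≤ 8 * (P ^ 3 + 1) := by linarith

/-- The remainder is in fact of degree four in the momentum; this passes to the weaker eighth power.
-/
theorem one_add_pow_four_le {P : ℝ} (hP : 0 ≤ P) : (1 + P) ^ 4 ≤ 16 * (P ^ 8 + 1) := by
  rcases le_total P 1 with h | h
  · calc (1 + P) ^ 4 ≤ (1 + 1) ^ 4 := by gcongr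
      _ ≤ 16 * (P ^ 8 + 1) := by nlinarith [pow_nonneg hP 8]
  · calc (1 + P) ^ 4 ≤ (P + P) ^ 4 := by gcongr
      _ = 16 * P ^ 4 := by ring
      _ ≤ 16 * P ^ 8 := by gcongr; norm_num
      _ ≤ 16 * (P ^ 8 + 1) := by linarith

end Leapfrog

/-! ### The main theorem -/

open Real Set Leapfrog in
theorem mainTheorem8 :
    ∃ K : ℝ → ℝ → ℝ → ℝ → ℝ,
      ∀ (B T : ℝ), 0 < T →
      ∀ (m : ℕ) (M : Matrix (Fin m) (Fin m) ℝ), M.PosDef →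
      ∀ V : Leapfrog.Vec m → ℝ, Leapfrog.AdmissiblePotential V B →
        -- the trajectory and the variational solution along it exist and are unique
        (∀ x : Leapfrog.Vec m × Leapfrog.Vec m,
          ∃! s : (ℝ → Leapfrog.Vec m) × (ℝ → Leapfrog.Vec m),
            Leapfrog.IsTrajectory M V x s.1 s.2) ∧
        (∀ (x : Leapfrog.Vec m × Leapfrog.Vec m) (q p : ℝ → Leapfrog.Vec m),
          Leapfrog.IsTrajectory M V x q p →
          ∃! w : (ℝ → Leapfrog.Vec m) × (ℝ → Leapfrog.Vec m),
            Leapfrog.IsVariationalSolution M V q p w.1 w.2) ∧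
        ∃ (α : Leapfrog.Vec m × Leapfrog.Vec m → ℝ)
          (ρ : Leapfrog.Vec m × Leapfrog.Vec m → ℝ → ℝ),
          (∀ x h, 0 < h →
            Leapfrog.energyError M V T x h = h ^ 2 * α x + h ^ 2 * ρ x h) ∧
          ∀ (x : Leapfrog.Vec m × Leapfrog.Vec m) (q p u v : ℝ → Leapfrog.Vec m),
            Leapfrog.IsTrajectory M V x q p →
            Leapfrog.IsVariationalSolution M V q p u v →
            -- the exact flow preserves the energy, so `Δ` is the energy error at time `T`
            Leapfrog.energy M V (q T, p T) = Leapfrog.energy M V x ∧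
            α x = inner ℝ (Leapfrog.op M⁻¹ (p T)) (u T)
              - inner ℝ (Leapfrog.force V (q T)) (v T) ∧
            |α x| ≤ K B T ‖Leapfrog.op M‖ ‖Leapfrog.op M⁻¹‖ *
              (Leapfrog.supNorm T p ^ 3
                + Leapfrog.supNorm T (fun t => Leapfrog.force V (q t)) ^ 2 + 1) ∧
            ∀ h, 0 < h → h ≤ 1 →
              |ρ x h| ≤ K B T ‖Leapfrog.op M‖ ‖Leapfrog.op M⁻¹‖ * h *
                (Leapfrog.supNorm T p ^ 8
                  + Leapfrog.supNorm T (fun t => Leapfrog.force V (q t)) ^ 2 + 1) := by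
  refine ⟨fun B T _ w => errorConstant (dataBound B T w), ?_⟩
  intro B T hT0 m M hM V hV
  -- One number dominates `1`, `B`, `‖op M⁻¹‖` and `T`; its summand `2 / T` gives `2 ≤ L * T`,
  -- needed to bound the force by the momentum.
  set L := dataBound B T ‖op M⁻¹‖ with hLdef
  have hw0 : 0 ≤ ‖op M⁻¹‖ := norm_nonneg _
  have hTi : 0 < 2 / T := by positivity
  have hBa := abs_nonneg B
  have hL : 1 ≤ L := by rw [hLdef, dataBound]; linarith
  have hB : B ≤ L := by rw [hLdef, dataBound]; linarith [le_abs_self B]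
  have hW : ‖op M⁻¹‖ ≤ L := by rw [hLdef, dataBound]; linarith
  have hT : T ≤ L := by rw [hLdef, dataBound]; linarith
  have hT2 : 2 ≤ L * T := by
    rw [← div_le_iff₀ hT0, hLdef, dataBound]; linarith
  have hL0 : 0 ≤ L := by linarith
  have hf := hV.isForceField hL hB
  have hsymm := inner_op_inv_comm hM
  have hE := existsUnique_isTrajectory (M := M) hf hW
  have hE' := fun (x : Vec m × Vec m) (q p : ℝ → Vec m) (h : IsTrajectory M V x q p) =>
    existsUnique_isVariationalSolution hf hW h
  refine ⟨hE, hE', ?_⟩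
  -- `α` has to depend on `x` alone, so solutions are chosen; uniqueness identifies them with any
  -- given ones.
  choose s hs hsu using hE
  choose r hr hru using fun x => hE' x _ _ (hs x)
  let α : Vec m × Vec m → ℝ := fun x =>
    inner ℝ (op M⁻¹ ((s x).2 T)) ((r x).1 T) - inner ℝ (force V ((s x).1 T)) ((r x).2 T)
  -- With `ρ` defined as the quotient the expansion is an identity; the content lies in the bound on
  -- `ρ`.
  refine ⟨α, fun x h => energyError M V T x h / h ^ 2 - α x, fun x h h0 => by field_simp; ring, ?_⟩
  intro x q p u v hx hw
  have hsx : (q, p) = s x := hsu x (q, p) hx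
  have hrx : (u, v) = r x := hru x (u, v) (by rw [← hsx]; exact hw)
  have hα : α x = inner ℝ (op M⁻¹ (p T)) (u T) - inner ℝ (force V (q T)) (v T) := by
    simp only [α, ← hsx, ← hrx]
  set P := supNorm T p with hPdef
  have hpP : ∀ t ∈ Icc 0 T, ‖p t‖ ≤ P := fun t ht => norm_le_supNorm hx.continuous_p ht
  have hP0 : 0 ≤ P := (norm_nonneg _).trans (hpP 0 ⟨le_rfl, hT0.le⟩)
  -- The factor `2 * L ^ 3` comes from `norm_force_le`, and `1 + P` ensures `1 ≤ R`.
  set R := 2 * L ^ 3 * (1 + P) with hRdef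
  have hL3 : 1 ≤ L ^ 3 := one_le_pow₀ hL
  have hPR : 1 + P ≤ R := by
    rw [hRdef]; exact le_mul_of_one_le_left (by linarith) (by linarith)
  have hR : 1 ≤ R := by linarith
  have hpR : ∀ t ∈ Icc 0 T, ‖p t‖ ≤ R := fun t ht => by linarith [hpP t ht]
  have hfR : ∀ t ∈ Icc 0 T, ‖force V (q t)‖ ≤ R := fun t ht =>
    (hf.norm_force_le hW hx.deriv_q hx.deriv_p hT hT2 hpP ht).trans (by
      rw [hRdef]; gcongr; linarith)
  have hA := hw.hasDerivAt_pairing hf hsymm hx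
  set A : ℝ → ℝ := fun t => inner ℝ (op M⁻¹ (p t)) (u t) - inner ℝ (force V (q t)) (v t) with hAdef
  have hA0 : A 0 = 0 := by simp [hAdef, hw.initial_u, hw.initial_v]
  have hαA : α x = A T := hα
  -- The momentum already dominates the force, so the force term in the bounds need only be
  -- nonnegative.
  have hF2 : 0 ≤ supNorm T (fun t => force V (q t)) ^ 2 := sq_nonneg _
  refine ⟨hx.energy_eq hf hsymm T, hα, ?_, fun h h0 h1 => ?_⟩
  · have h2 := hf.abs_primitive_le hW hA hA0 hR hT0.le hT hpR hfR
    rw [hαA]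
    have h3 : 0 ≤ 3201 * L ^ 12 * exp (2 * L ^ 4) ^ 4 * (256 * L ^ 12) := by positivity
    calc |A T| ≤ L ^ 6 * R ^ 3 := h2
      _ = 8 * L ^ 15 * (1 + P) ^ 3 := by rw [hRdef]; ring
      _ ≤ 8 * L ^ 15 * (8 * (P ^ 3 + 1)) := by gcongr; exact one_add_pow_three_le hP0
      _ = 64 * L ^ 15 * (P ^ 3 + 1) := by ring
      _ ≤ errorConstant L * (P ^ 3 + supNorm T (fun t => force V (q t)) ^ 2 + 1) := by
        refine mul_le_mul ?_ (by linarith) (by positivity) ?_ <;> rw [errorConstant]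
        · linarith
        · positivity
  · have h2 := hf.energy_error hW hsymm hx.deriv_q hx.deriv_p hA hA0 hR h0 h1 hT0.le hT hpR hfR
      (Q := fun n => ((step M V h)^[n] x).1) (Z := fun n => ((step M V h)^[n] x).2)
      (congrArg Prod.fst hx.initial.symm) (congrArg Prod.snd hx.initial.symm)
      (fun n => by rw [Function.iterate_succ_apply', step_fst])
      (fun n => by rw [Function.iterate_succ_apply', step_snd])
    have hx1 : p 0 = x.2 := congrArg Prod.snd hx.initial
    have hx2 : q 0 = x.1 := congrArg Prod.fst hx.initial
    rw [hx1, hx2] at h2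
    have h3 : |energyError M V T x h - h ^ 2 * A T|
        ≤ 3201 * L ^ 12 * exp (2 * L ^ 4) ^ 4 * R ^ 4 * h ^ 3 := h2
    have h4 : energyError M V T x h / h ^ 2 - α x
        = (energyError M V T x h - h ^ 2 * A T) / h ^ 2 := by
      rw [hαA]; field_simp
    have h5 : 0 ≤ 64 * L ^ 15 := by positivity
    change |energyError M V T x h / h ^ 2 - α x| ≤ errorConstant L * h * _
    rw [h4, abs_div, abs_of_pos (by positivity : 0 < h ^ 2), div_le_iff₀ (by positivity)]
    calc |energyError M V T x h - h ^ 2 * A T|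
        ≤ 3201 * L ^ 12 * exp (2 * L ^ 4) ^ 4 * R ^ 4 * h ^ 3 := h3
      _ = 3201 * L ^ 12 * exp (2 * L ^ 4) ^ 4 * (16 * L ^ 12 * (1 + P) ^ 4) * h ^ 3 := by
        rw [hRdef]; ring
      _ ≤ 3201 * L ^ 12 * exp (2 * L ^ 4) ^ 4 * (16 * L ^ 12 * (16 * (P ^ 8 + 1))) * h ^ 3 := by
        gcongr; exact one_add_pow_four_le hP0
      _ = 3201 * L ^ 12 * exp (2 * L ^ 4) ^ 4 * (256 * L ^ 12) * (P ^ 8 + 1) * h ^ 3 := by ring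
      _ ≤ errorConstant L * (P ^ 8 + supNorm T (fun t => force V (q t)) ^ 2 + 1) * h ^ 3 := by
        refine mul_le_mul_of_nonneg_right ?_ (by positivity)
        refine mul_le_mul ?_ (by linarith) (by positivity) ?_ <;> rw [errorConstant]
        · linarith
        · positivity
      _ = errorConstant L * h * (P ^ 8 + supNorm T (fun t => force V (q t)) ^ 2 + 1) * h ^ 2 := by
        ring
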